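/- Let $d\in\{2,3\}$, $k\ge 1$, let $\Omega\subset\mathbb R^d$ be a bounded open set with Lipschitz boundary $\Gamma$ and outward unit normal $\mathbf n_\Gamma$, and let $\gamma_{\mathbf u}>0$, $\sigma,\rho>0$ and $N\in\mathbb N$ be given. Let $\mathcal B_h$ be a finite conforming mesh of closed $d$-simplices covering $\Omega$; write $h_T=\operatorname{diam}T$ and $h=\max_{T\in\mathcal B_h}h_T$. Let $\mathcal T_h=\{T\in\mathcal B_h:T\cap\Omega\ne\emptyset\}$ be the active mesh, $\Omega_{\mathcal T}=\bigcup_{T\in\mathcal T_h}T$, let $\mathcal F_h^{int}$ be the set of faces $F=T^+\cap T^-$ shared by two elements $T^\pm\in\mathcal T_h$, let $G_h=\{T\in\mathcal T_h:T\cap\Gamma\neq\emptyset\}$ be the set of cut elements, and let $\mathcal F_G$ be the set of faces of elements of $G_h$ that are not contained in $\partial\Omega_{\mathcal T}$. Assume that * (shape regularity) every $T\in\mathcal B_h$ contains a ball of diameter at least $h_T/\sigma$; * (quasi-uniformity) $h\le\rho\,h_T$ for all $T\in\mathcal T_h$; * (resolution of the boundary) for each $T\in G_h$ there are at most $N$ elements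 $T=T_1,\dots,T_m$ of $\mathcal T_h$ with $T_j\cap T_{j+1}\in\mathcal F_h^{int}$ for $1\le j<m$ and $T_m\in\mathcal T_h\setminus G_h$. Let $V_h$ be the space of functions $\mathbf v_h:\Omega_{\mathcal T}\to\mathbb R^d$ whose restriction to each $T\in\mathcal T_h$ is a vector of polynomials of degree at most $k$, and let $\nabla$ be the elementwise gradient. On $F=T^+\cap T^-$ let $\mathbf n_F$ be the unit normal pointing out of $T^+$, $[\![w]\!]=w^+-w^-$, $\{w\}=\tfrac12(w^++w^-)$, where $w^\pm$ are the traces from $T^\pm$, and $h_F=\min\{h_{T^+},h_{T^-}\}$; traces on $\Gamma$ are taken from inside $\Omega$. Put $\partial_{\mathbf n}^iw=\sum_{|\alpha|=i}\frac1{\alpha!}D^\alpha w\,\mathbf n^\alpha$ and $$\begin{aligned} a_h(\mathbf u,\mathbf v)={}&\int_\Omega\nabla\mathbf u:\nabla\mathbf v\,dx-\sum_{F\in\mathcal F_h^{int}}\int_{F\cap\Omega}\big(\{\nabla\mathbf u\}\mathbf n_F\cdot[\![\mathbf v]\!]+\{\nabla\mathbf v\}\mathbf n_F\cdot[\![\mathbf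 u]\!]\big)ds\\ &-\int_\Gamma\mathbf u\cdot(\nabla\mathbf v\,\mathbf n_\Gamma)\,ds-\int_\Gamma\mathbf v\cdot(\nabla\mathbf u\,\mathbf n_\Gamma)\,ds+\frac{\beta}{h}\int_\Gamma\mathbf u\cdot\mathbf v\,ds+\frac{\beta}{h}\sum_{F\in\mathcal F_h^{int}}\int_{F\cap\Omega}[\![\mathbf u]\!]\cdot[\![\mathbf v]\!]\,ds,\\ j_u(\mathbf u,\mathbf v)={}&\gamma_{\mathbf u}\sum_{F\in\mathcal F_G}\sum_{i=0}^k\int_Fh_F^{2i-1}[\![\partial^i_{\mathbf n_F}\mathbf u]\!]\cdot[\![\partial^i_{\mathbf n_F}\mathbf v]\!]\,ds,\\ |||\mathbf v|||_V^2={}&\|\nabla\mathbf v\|^2_{L^2(\Omega_{\mathcal T})}+h^{-1}\|\mathbf v\|^2_{L^2(\Gamma)}+h^{-1}\sum_{F\in\mathcal F_h^{int}}\|[\![\mathbf v]\!]\|^2_{L^2(F\cap\Omega)}. \end{aligned}$$ Then there is $\beta_0>0$, depending only on $d,k,\Omega,\gamma_{\mathbf u},\sigma,\rho,N$, such that for every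 $\beta\ge\beta_0$ there is $c_a>0$, depending only on $\beta$ and the same data, in particular neither on the mesh, nor on $h$, nor on how $\Gamma$ cuts the mesh, such that for every mesh as above $$c_a\,|||\mathbf v_h|||_V^2\le a_h(\mathbf v_h,\mathbf v_h)+j_u(\mathbf v_h,\mathbf v_h)\qquad\text{for all }\mathbf v_h\in V_h.$$ -/

import Mathlib

open scoped Topology MeasureTheory

namespace UnfittedDG

noncomputable section

/-- Euclidean space `ℝ^d`. -/
abbrev Space (d : ℕ) : Type := EuclideanSpace ℝ (Fin d)

/-! ### The physical domain -/

/-- Near each of its boundary points, `Ω` is the set of points lying strictly above the graph of a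
Lipschitz function, in some direction `e`; `g` is only evaluated on the hyperplane orthogonal
to `e`. -/
def HasLipschitzBoundary {d : ℕ} (Ω : Set (Space d)) : Prop :=
  ∀ x ∈ frontier Ω, ∃ r > (0 : ℝ), ∃ e : Space d, ‖e‖ = 1 ∧
    ∃ (K : NNReal) (g : Space d → ℝ), LipschitzWith K g ∧
      ∀ y ∈ Metric.ball x r, y ∈ Ω ↔ g (y - inner ℝ e y • e) < inner ℝ e y

/-- `ν` is the outward unit normal of `Ω` at the boundary point `x`: close to `x`, every cone
around `-ν` of aperture less than a half space lies in `Ω`, and every such cone around `ν` lies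
outside `Ω`. There is at most one such `ν`, and for a Lipschitz boundary there is one at
almost every boundary point (where the local graph function is differentiable). -/
def IsOutwardNormal {d : ℕ} (Ω : Set (Space d)) (x ν : Space d) : Prop :=
  ‖ν‖ = 1 ∧ ∀ ε > (0 : ℝ), ∀ᶠ y in 𝓝 x,
    (inner ℝ (y - x) ν < -(ε * ‖y - x‖) → y ∈ Ω) ∧
    (ε * ‖y - x‖ < inner ℝ (y - x) ν → y ∉ Ω)

open Classical in
/-- The field `n_Γ` of outward unit normals (zero at the boundary points without a normal). -/
def outwardNormal {d : ℕ} (Ω : Set (Space d)) (x : Space d) : Space d :=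
  if h : ∃ ν, IsOutwardNormal Ω x ν then h.choose else 0

/-! ### Meshes -/

/-- The closed simplex with vertex set `T`. -/
def cell {d : ℕ} (T : Finset (Space d)) : Set (Space d) :=
  convexHull ℝ (T : Set (Space d))

/-- A finite conforming mesh of nondegenerate `d`-simplices, each given by its set of vertices:
two elements meet in the simplex spanned by their common vertices (or not at all). -/
structure Mesh (d : ℕ) where
  elements : Finset (Finset (Space d))
  indep : ∀ T ∈ elements, AffineIndependent ℝ ((↑) : T → Space d)
  card : ∀ T ∈ elements, T.card = d + 1
  conforming : ∀ T ∈ elements, ∀ T' ∈ elements,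
    cell T ∩ cell T' ⊆ convexHull ℝ ((T : Set (Space d)) ∩ (T' : Set (Space d)))

namespace Mesh

variable {d : ℕ} (M : Mesh d) (Ω : Set (Space d))

/-- The closed region covered by the background mesh. -/
def region : Set (Space d) := ⋃ T ∈ M.elements, cell T

/-- The global mesh size `h`, the largest element diameter. -/
def size : ℝ := ⨆ T : M.elements, Metric.diam (cell (T : Finset (Space d)))

/-- Shape regularity with constant `σ`: each element `T` contains a ball whose diameter is at
least `diam T / σ`. -/
def ShapeRegular (σ : ℝ) : Prop :=
  ∀ T ∈ M.elements, ∃ (c : Space d) (r : ℝ), 0 < r ∧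
    Metric.closedBall c r ⊆ cell T ∧ Metric.diam (cell T) ≤ σ * (2 * r)

open Classical in
/-- The active mesh `T_h`: the elements that meet `Ω`. -/
def active : Finset (Finset (Space d)) :=
  M.elements.filter fun T => (cell T ∩ Ω).Nonempty

/-- The extended domain `Ω_T`, the union of the active elements. -/
def extended : Set (Space d) := ⋃ T ∈ M.active Ω, cell T

open Classical in
/-- The cut elements `G_h`: the active elements that meet the boundary of `Ω`. -/
def cut : Finset (Finset (Space d)) :=
  (M.active Ω).filter fun T => (cell T ∩ frontier Ω).Nonempty

/-- Comparability of the global mesh size with the diameters of the active elements. -/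
def QuasiUniform (ρ : ℝ) : Prop :=
  ∀ T ∈ M.active Ω, M.size ≤ ρ * Metric.diam (cell T)

open Classical in
/-- The interior faces `F = T⁺ ∩ T⁻` of the active mesh, each represented by the two ordered
pairs `(T⁺, T⁻)` and `(T⁻, T⁺)`: two distinct active elements with `d` common vertices. -/
def interiorFaces : Finset (Finset (Space d) × Finset (Space d)) :=
  (M.active Ω ×ˢ M.active Ω).filter fun P => P.1 ≠ P.2 ∧ (P.1 ∩ P.2).card = d

open Classical in
/-- The ghost penalty faces `F_G`, the faces of cut elements not contained in the boundary of
the extended domain (that is, those shared with another active element), represented as ordered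
pairs as above. -/
def ghostFaces : Finset (Finset (Space d) × Finset (Space d)) :=
  (M.interiorFaces Ω).filter fun P => P.1 ∈ M.cut Ω ∨ P.2 ∈ M.cut Ω

/-- From each cut element `T` one can walk to an active element that is not cut, along at most `N`
active elements `T = T_1, …, T_m` (`m ≤ N`), consecutive ones sharing an interior face. -/
def WalkToUncut (N : ℕ) : Prop :=
  ∀ T ∈ M.cut Ω, ∃ (m : ℕ) (c : ℕ → Finset (Space d)), m + 1 ≤ N ∧ c 0 = T ∧
    c m ∈ M.active Ω ∧ c m ∉ M.cut Ω ∧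
    ∀ j < m, (c j, c (j + 1)) ∈ M.interiorFaces Ω

/-- The velocity space `V_h`: on each active element the function `v` coincides with a vector
field whose components are polynomials of total degree at most `k`. Values on the faces, a null
set, are irrelevant. -/
def IsDiscrete (k : ℕ) (v : Space d → Space d) : Prop :=
  ∀ T ∈ M.active Ω, ∃ P : Fin d → MvPolynomial (Fin d) ℝ,
    (∀ i, (P i).totalDegree ≤ k) ∧
    ∀ x ∈ interior (cell T), ∀ i, v x i = MvPolynomial.eval (fun l => x l) (P i)

end Mesh

/-! ### Traces, averages and jumps -/

/-- The trace at `x ∈ T` of `f` from the interior of the element `T`. -/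
def elemTrace {d : ℕ} {X : Type*} [TopologicalSpace X] [Nonempty X]
    (T : Finset (Space d)) (f : Space d → X) (x : Space d) : X :=
  Filter.limUnder (𝓝[interior (cell T)] x) f

/-- The face `F = T ∩ T'`. -/
def face {d : ℕ} (P : Finset (Space d) × Finset (Space d)) : Set (Space d) :=
  cell P.1 ∩ cell P.2

/-- The local mesh size `h_F = min (h_T, h_T')`. -/
def faceSize {d : ℕ} (P : Finset (Space d) × Finset (Space d)) : ℝ :=
  min (Metric.diam (cell P.1)) (Metric.diam (cell P.2))

/-- `n` is a unit normal to the face `F = T ∩ T'` pointing out of `T`. (Exchanging the roles of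
two vertices of `F` shows that `n` is orthogonal to `F`.) -/
def IsFaceNormal {d : ℕ} (P : Finset (Space d) × Finset (Space d)) (n : Space d) : Prop :=
  ‖n‖ = 1 ∧ ∀ x ∈ P.1, x ∈ P.2 → ∀ y ∈ P.1, inner ℝ n (y - x) ≤ 0

open Classical in
/-- The unit normal `n_F` to `F = T⁺ ∩ T⁻`, outward from `T⁺`. -/
def faceNormal {d : ℕ} (P : Finset (Space d) × Finset (Space d)) : Space d :=
  if h : ∃ n, IsFaceNormal P n then h.choose else 0

/-- The jump `f⁺ - f⁻` across a face. -/
def jump {d : ℕ} {X : Type*} [NormedAddCommGroup X]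
    (P : Finset (Space d) × Finset (Space d)) (f : Space d → X) (x : Space d) : X :=
  elemTrace P.1 f x - elemTrace P.2 f x

/-- The average `(f⁺ + f⁻) / 2` across a face. -/
def average {d : ℕ} {X : Type*} [NormedAddCommGroup X] [NormedSpace ℝ X]
    (P : Finset (Space d) × Finset (Space d)) (f : Space d → X) (x : Space d) : X :=
  (1 / 2 : ℝ) • (elemTrace P.1 f x + elemTrace P.2 f x)

/-- The part of the boundary `Γ` of `Ω` on which the traces from inside `Ω` are those from `T`:
the boundary points at which the inward normal enters the interior of `T`. These sets are disjoint
for different active elements `T` and cover almost all of `Γ`. -/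
def boundaryPart {d : ℕ} (Ω : Set (Space d)) (T : Finset (Space d)) : Set (Space d) :=
  {x ∈ frontier Ω | ∀ᶠ t in 𝓝[>] (0 : ℝ), x - t • outwardNormal Ω x ∈ interior (cell T)}

/-- The Frobenius product `A : B`. -/
def frob {d : ℕ} (A B : Space d →L[ℝ] Space d) : ℝ :=
  ∑ j : Fin d, inner ℝ (A (EuclideanSpace.single j 1)) (B (EuclideanSpace.single j 1))

/-- The normal derivative `∂_n^i v = ∑_{|α| = i} (1 / α!) D^α v n^α`, which equals
`(1 / i!) D^i v (n, …, n)`. -/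
def normalDeriv {d : ℕ} (i : ℕ) (n : Space d) (v : Space d → Space d) (x : Space d) : Space d :=
  ((Nat.factorial i : ℝ)⁻¹) • iteratedFDeriv ℝ i v x (fun _ => n)

/-! ### Forms and norm

At a point inside an element `fderiv ℝ v` is the broken gradient of `v`; the union of the element
boundaries is a null set. Surface integrals are with respect to the `(d-1)`-dimensional Hausdorff
measure, normalized as Lebesgue measure on hyperplanes. -/

namespace Mesh

variable {d : ℕ} (M : Mesh d) (Ω : Set (Space d))

/-- Sum over all interior faces. Each face occurs as two ordered pairs, with the same value for the
summands used below, whence the factor `1 / 2`. -/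
def faceSum (φ : Finset (Space d) × Finset (Space d) → ℝ) : ℝ :=
  (1 / 2) * ∑ P ∈ M.interiorFaces Ω, φ P

/-- Sum over all ghost penalty faces. -/
def ghostSum (φ : Finset (Space d) × Finset (Space d) → ℝ) : ℝ :=
  (1 / 2) * ∑ P ∈ M.ghostFaces Ω, φ P

/-- The integral over `Γ` of an integrand depending on the element from whose interior the traces
are taken. -/
def boundaryIntegral (φ : Finset (Space d) → Space d → ℝ) : ℝ :=
  ∑ T ∈ M.active Ω, ∫ x in boundaryPart Ω T, φ T x ∂μHE[d - 1]

/-- The symmetric interior penalty form `a_h` with penalty parameter `β`. -/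
def aForm (β : ℝ) (u v : Space d → Space d) : ℝ :=
  (∫ x in Ω, frob (fderiv ℝ u x) (fderiv ℝ v x))
  - M.faceSum Ω (fun P => ∫ x in face P ∩ Ω,
      (inner ℝ (average P (fderiv ℝ u) x (faceNormal P)) (jump P v x)
        + inner ℝ (average P (fderiv ℝ v) x (faceNormal P)) (jump P u x)) ∂μHE[d - 1])
  - M.boundaryIntegral Ω (fun T x =>
      inner ℝ (elemTrace T u x) (elemTrace T (fderiv ℝ v) x (outwardNormal Ω x)))
  - M.boundaryIntegral Ω (fun T x =>
      inner ℝ (elemTrace T v x) (elemTrace T (fderiv ℝ u) x (outwardNormal Ω x)))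
  + β * M.size⁻¹ * M.boundaryIntegral Ω (fun T x =>
      inner ℝ (elemTrace T u x) (elemTrace T v x))
  + β * M.size⁻¹ * M.faceSum Ω (fun P => ∫ x in face P ∩ Ω,
      inner ℝ (jump P u x) (jump P v x) ∂μHE[d - 1])

/-- The velocity ghost penalty form `j_u` with parameter `γ`, for polynomial degree `k`. -/
def jForm (k : ℕ) (γ : ℝ) (u v : Space d → Space d) : ℝ :=
  γ * M.ghostSum Ω (fun P => ∑ i ∈ Finset.range (k + 1),
    ∫ x in face P, faceSize P ^ (2 * (i : ℤ) - 1) *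
      inner ℝ (jump P (normalDeriv i (faceNormal P) u) x)
        (jump P (normalDeriv i (faceNormal P) v) x) ∂μHE[d - 1])

/-- The square of the norm `|||v|||_V`. -/
def normVSq (v : Space d → Space d) : ℝ :=
  (∫ x in M.extended Ω, frob (fderiv ℝ v x) (fderiv ℝ v x))
  + M.size⁻¹ * M.boundaryIntegral Ω (fun T x => ‖elemTrace T v x‖ ^ 2)
  + M.size⁻¹ * M.faceSum Ω (fun P => ∫ x in face P ∩ Ω, ‖jump P v x‖ ^ 2 ∂μHE[d - 1])

end Mesh

end

end UnfittedDG

namespace UnfittedDG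

noncomputable section

open MeasureTheory
open scoped ContDiff Pointwise

/-! On each active element `T` the discrete function is a polynomial field `p T`. In `a_h(v,v) +
j_u(v,v)` only the consistency terms have no sign. Young's inequality with weight `δ h` bounds them
by `δ h ∫ |∇p_T|²` plus `(δ h)⁻¹` times the squared traces or jumps over the same surface pieces.
The latter are absorbed by the penalties once `β ≥ δ⁻¹ + 1`.

For the former, a discrete trace inequality (`exists_surface_integral_le`) gives `h ∫_S |∇p_T|² ≤ C
∫_T |∇p_T|²` for every `S ⊆ T` of surface measure `O(h^(d-1))`. Faces are planar and the boundary is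
locally a Lipschitz graph (`exists_measure_frontier_inter_le`), so the measure bound does not depend
on how the boundary cuts `T`. The price is that the energy on whole elements appears, not only on `T
∩ Ω`.

That energy is recovered by the ghost penalty (`exists_sum_cellEnergy_le`). Across a face, `∇p_T =
∇p_T' + ∇(p_T - p_T')`. The first summand is controlled on `T` by the energy on the neighbour `T'`.
The second is controlled by the jumps of all normal derivatives up to order `k`, because these
determine a polynomial of degree `k` along every normal line. Walking at most `N` elements from a
cut element leads to an uncut one, which lies inside `Ω`. Shape regularity bounds the number of
neighbours, hence the overcounting (`sum_le_of_walks`).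

Both polynomial estimates come from one fact: on a finite-dimensional space, a linear map vanishing
on the kernel of another is bounded by it (`exists_norm_le_of_ker_le`). It is applied on a unit ball
or unit disc and transported by similarities, which produces the powers of `h`.
`coercivity_of_bounds` chooses `δ` and collects the terms. -/

/-! ### Polynomial vector fields -/

/-- Evaluation of a vector of polynomials. -/
def evalVec (d : ℕ) : (Fin d → MvPolynomial (Fin d) ℝ) →ₗ[ℝ] (Space d → Space d) where
  toFun P x := WithLp.toLp 2 fun i => MvPolynomial.eval (fun l => x l) (P i)
  map_add' P Q := by ext x i; simp
  map_smul' c P := by ext x i; simp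

/-- Vector fields whose components are polynomials of total degree at most `k`. -/
def polyFun (d k : ℕ) : Submodule ℝ (Space d → Space d) :=
  (Submodule.pi Set.univ fun _ : Fin d => MvPolynomial.restrictTotalDegree (Fin d) ℝ k).map
    (evalVec d)

theorem mem_polyFun {d k : ℕ} {f : Space d → Space d} :
    f ∈ polyFun d k ↔ ∃ P : Fin d → MvPolynomial (Fin d) ℝ, (∀ i, (P i).totalDegree ≤ k) ∧
      ∀ x i, f x i = MvPolynomial.eval (fun l => x l) (P i) := by
  constructor
  · rintro ⟨P, hP, rfl⟩
    refine ⟨P, fun i => ?_, fun x i => rfl⟩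
    exact (MvPolynomial.mem_restrictTotalDegree _ _ _).1 (hP i (Set.mem_univ i))
  · rintro ⟨P, hP, h⟩
    refine ⟨P, fun i _ => (MvPolynomial.mem_restrictTotalDegree _ _ _).2 (hP i), ?_⟩
    ext x i
    exact (h x i).symm

instance (d k : ℕ) : FiniteDimensional ℝ (polyFun d k) := by
  have : Module.Finite ℝ (Submodule.pi Set.univ
      fun _ : Fin d => MvPolynomial.restrictTotalDegree (Fin d) ℝ k) := by
    let φ : (Submodule.pi Set.univ
      fun _ : Fin d => MvPolynomial.restrictTotalDegree (Fin d) ℝ k) →ₗ[ℝ]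
        (Fin d → MvPolynomial.restrictTotalDegree (Fin d) ℝ k) :=
      { toFun := fun p i => ⟨p.1 i, p.2 i (Set.mem_univ i)⟩
        map_add' := fun _ _ => rfl
        map_smul' := fun _ _ => rfl }
    refine Module.Finite.of_injective φ fun p q h => Subtype.ext (funext fun i => ?_)
    exact congrArg Subtype.val (congrFun h i)
  exact inferInstanceAs (Module.Finite ℝ (Submodule.map (evalVec d) _))

theorem analyticOnNhd_of_mem_polyFun {d k : ℕ} {f : Space d → Space d} (hf : f ∈ polyFun d k) :
    AnalyticOnNhd ℝ f Set.univ := by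
  obtain ⟨P, -, h⟩ := mem_polyFun.1 hf
  have : f = fun x => (EuclideanSpace.equiv (Fin d) ℝ).symm
      fun i => MvPolynomial.eval (fun l => x l) (P i) := by
    ext x i; exact h x i
  rw [this]
  refine (ContinuousLinearEquiv.analyticOnNhd _ Set.univ).comp ?_ (Set.mapsTo_univ _ _)
  refine AnalyticOnNhd.pi fun i => ?_
  exact AnalyticOnNhd.eval_continuousLinearMap
    ((EuclideanSpace.equiv (Fin d) ℝ) : Space d →L[ℝ] (Fin d → ℝ)) (P i)

theorem contDiff_of_mem_polyFun {d k : ℕ} {f : Space d → Space d} (hf : f ∈ polyFun d k)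
    {n : WithTop ℕ∞} : ContDiff ℝ n f :=
  (analyticOnNhd_of_mem_polyFun hf).contDiff

theorem totalDegree_bind₁_le {σ τ : Type*} (g : σ → MvPolynomial τ ℝ)
    (hg : ∀ i, (g i).totalDegree ≤ 1) (p : MvPolynomial σ ℝ) :
    (MvPolynomial.bind₁ g p).totalDegree ≤ p.totalDegree := by
  classical
  rw [MvPolynomial.bind₁, MvPolynomial.aeval_def, MvPolynomial.eval₂_eq]
  refine MvPolynomial.totalDegree_finsetSum_le fun s hs => ?_
  refine (MvPolynomial.totalDegree_mul _ _).trans ?_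
  rw [MvPolynomial.algebraMap_eq, MvPolynomial.totalDegree_C, zero_add]
  refine (MvPolynomial.totalDegree_finsetProd _ _).trans ?_
  refine le_trans (Finset.sum_le_sum fun i _ => ?_) (MvPolynomial.le_totalDegree hs)
  refine (MvPolynomial.totalDegree_pow _ _).trans ?_
  simpa using Nat.mul_le_mul_left (s i) (hg i)

/-- Substituting affine forms does not raise the total degree. This invariance lets estimates on a
reference ball or disc be transported by similarities. -/
theorem comp_affine_mem_polyFun {d k : ℕ} {f : Space d → Space d} (hf : f ∈ polyFun d k)
    (c : Space d) (A : Space d →ₗ[ℝ] Space d) : (fun x => f (c + A x)) ∈ polyFun d k := by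
  obtain ⟨P, hP, h⟩ := mem_polyFun.1 hf
  let g : Fin d → MvPolynomial (Fin d) ℝ := fun i =>
    MvPolynomial.C (c i) + ∑ j, MvPolynomial.C (A (EuclideanSpace.single j 1) i) *
      MvPolynomial.X j
  have hg : ∀ i, (g i).totalDegree ≤ 1 := fun i => by
    refine (MvPolynomial.totalDegree_add _ _).trans (max_le (by simp) ?_)
    refine MvPolynomial.totalDegree_finsetSum_le fun j _ => ?_
    exact (MvPolynomial.totalDegree_mul _ _).trans (by simp)
  have hgx : ∀ x : Space d, ∀ i, MvPolynomial.eval (fun l => x l) (g i) = (c + A x) i := by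
    intro x i
    have hx : x = ∑ j, x j • EuclideanSpace.single j (1 : ℝ) := by
      ext l; simp [Finset.sum_apply, Pi.single_apply]
    conv_rhs => rw [hx]
    simp [g, mul_comm]
  refine mem_polyFun.2 ⟨fun i => MvPolynomial.bind₁ g (P i),
    fun i => (totalDegree_bind₁_le g hg _).trans (hP i), fun x i => ?_⟩
  rw [h]
  change _ = MvPolynomial.eval _ (MvPolynomial.bind₁ g (P i))
  have := MvPolynomial.eval₂Hom_bind₁ (RingHom.id ℝ) (fun l => x l) g (P i)
  refine Eq.trans ?_ this.symm
  change _ = MvPolynomial.eval _ (P i)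
  congr 2
  ext l
  exact (hgx x l).symm

theorem exists_polynomial_line {d k : ℕ} {f : Space d → Space d} (hf : f ∈ polyFun d k)
    (y n : Space d) (i : Fin d) : ∃ r : Polynomial ℝ, r.natDegree ≤ k ∧
      ∀ t : ℝ, r.eval t = f (y + t • n) i := by
  obtain ⟨P, hP, h⟩ := mem_polyFun.1 hf
  refine ⟨MvPolynomial.aeval (fun l => Polynomial.C (y l) + Polynomial.C (n l) * Polynomial.X)
    (P i), ?_, fun t => ?_⟩
  · rw [MvPolynomial.aeval_def, MvPolynomial.eval₂_eq]
    refine Polynomial.natDegree_sum_le_of_forall_le _ _ fun s hs => ?_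
    refine Polynomial.natDegree_mul_le.trans ?_
    rw [Polynomial.algebraMap_eq, Polynomial.natDegree_C, zero_add]
    refine (Polynomial.natDegree_prod_le _ _).trans ?_
    refine le_trans (Finset.sum_le_sum fun l _ => ?_)
      ((MvPolynomial.le_totalDegree hs).trans (hP i))
    refine Polynomial.natDegree_pow_le.trans ?_
    have : (Polynomial.C (y l) + Polynomial.C (n l) * Polynomial.X).natDegree ≤ 1 := by
      compute_degree
    simpa using Nat.mul_le_mul_left (s l) this
  · rw [h, ← Polynomial.coe_evalRingHom, MvPolynomial.aeval_def, MvPolynomial.hom_eval₂]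
    have : (Polynomial.evalRingHom t).comp (algebraMap ℝ (Polynomial ℝ)) = RingHom.id ℝ := by
      ext; simp
    rw [this]
    change MvPolynomial.eval _ _ = _
    congr 2
    ext l
    rw [Polynomial.coe_evalRingHom]
    simp only [Polynomial.eval_add, Polynomial.eval_mul, Polynomial.eval_C, Polynomial.eval_X,
      PiLp.add_apply, PiLp.smul_apply, smul_eq_mul, mul_comm]

/-- Chain rule along `t ↦ x + t n`: the normal derivatives are the Taylor coefficients of the
restriction of `f` to the normal line. -/
theorem normalDeriv_eq_line {d : ℕ} {f : Space d → Space d} (hf : ContDiff ℝ ∞ f) (i : ℕ)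
    (n x : Space d) : normalDeriv i n f x =
      ((Nat.factorial i : ℝ)⁻¹) • iteratedDeriv i (fun t : ℝ => f (x + t • n)) 0 := by
  have h1 : ContDiff ℝ ∞ (fun z => f (x + z)) := hf.comp (contDiff_const.add contDiff_id)
  have := ContinuousLinearMap.iteratedFDeriv_comp_right
    (ContinuousLinearMap.toSpanSingleton ℝ n) h1 (0 : ℝ) (i := i) (by exact_mod_cast le_top)
  rw [normalDeriv, iteratedDeriv_eq_iteratedFDeriv]
  have h2 : (fun t : ℝ => f (x + t • n)) =
    (fun z => f (x + z)) ∘ (ContinuousLinearMap.toSpanSingleton ℝ n) := by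
    ext t; simp
  rw [h2, this, iteratedFDeriv_comp_add_left]
  simp [ContinuousMultilinearMap.compContinuousLinearMap_apply]

/-- Each component restricted to the line is a univariate polynomial of degree at most `k`, and the
hypothesis kills all its coefficients. This is why the ghost penalty must include every order from
`0` to `k`. -/
theorem eq_zero_on_line {d k : ℕ} {f : Space d → Space d} (hf : f ∈ polyFun d k)
    (y n : Space d) (h : ∀ i ≤ k, normalDeriv i n f y = 0) (t : ℝ) : f (y + t • n) = 0 := by
  ext j
  obtain ⟨r, hr, hrt⟩ := exists_polynomial_line hf y n j
  have hc : ContDiff ℝ ∞ (fun t : ℝ => f (y + t • n)) :=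
    (contDiff_of_mem_polyFun hf).comp (contDiff_const.add (contDiff_id.smul contDiff_const))
  suffices r = 0 by rw [← hrt, this]; simp
  ext i
  rcases lt_or_ge k i with hi | hi
  · simpa using Polynomial.coeff_eq_zero_of_natDegree_lt (hr.trans_lt hi)
  have h0 : iteratedDeriv i (fun t : ℝ => f (y + t • n)) 0 = 0 := by
    have := h i hi
    rw [normalDeriv_eq_line (contDiff_of_mem_polyFun hf)] at this
    simpa [Nat.factorial_ne_zero] using this
  have h1 : iteratedDeriv i (fun t : ℝ => r.eval t) 0 = 0 := by
    have e : (fun t : ℝ => r.eval t) =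
        (EuclideanSpace.proj j : Space d →L[ℝ] ℝ) ∘ (fun t : ℝ => f (y + t • n)) := by
      ext t; simp [hrt]
    rw [e, iteratedDeriv_eq_iteratedFDeriv,
      ContinuousLinearMap.iteratedFDeriv_comp_left _ hc.contDiffAt (by exact_mod_cast le_top)]
    rw [ContinuousLinearMap.compContinuousMultilinearMap_coe, Function.comp_apply,
      ← iteratedDeriv_eq_iteratedFDeriv, h0, map_zero]
  have h2 : ∀ (i : ℕ) (q : Polynomial ℝ),
      iteratedDeriv i (fun t => q.eval t) = fun t => (Polynomial.derivative^[i] q).eval t := by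
    intro i
    induction i with
    | zero => intro q; simp
    | succ i ih =>
      intro q
      rw [iteratedDeriv_succ', Function.iterate_succ_apply, ← ih]
      congr 1
      ext t; simp
  rw [h2] at h1
  beta_reduce at h1
  rw [← Polynomial.coeff_zero_eq_eval_zero, Polynomial.coeff_iterate_derivative] at h1
  simpa [Nat.descFactorial_self, Nat.factorial_ne_zero] using h1

/-! ### Equivalence of norms -/

/-- `A` factors through the range of `B`, and a linear map on that finite-dimensional range is
bounded. No norm on `W` is needed, and `B` may have a kernel, as the gradient has on constants. -/
theorem exists_norm_le_of_ker_le {W E F : Type*} [AddCommGroup W] [Module ℝ W]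
    [FiniteDimensional ℝ W] [NormedAddCommGroup E] [NormedSpace ℝ E] [NormedAddCommGroup F]
    [NormedSpace ℝ F] (A : W →ₗ[ℝ] E) (B : W →ₗ[ℝ] F) (h : ∀ w, B w = 0 → A w = 0) :
    ∃ C : ℝ, 0 ≤ C ∧ ∀ w, ‖A w‖ ≤ C * ‖B w‖ := by
  obtain ⟨g, hg⟩ := B.rangeRestrict.exists_rightInverse_of_surjective B.range_rangeRestrict
  let T : LinearMap.range B →L[ℝ] E := LinearMap.toContinuousLinearMap (A ∘ₗ g)
  refine ⟨‖T‖, T.opNorm_nonneg, fun w => ?_⟩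
  have h1 : A w = T (B.rangeRestrict w) := by
    have h2 : B (w - g (B.rangeRestrict w)) = 0 := by
      have := congrArg Subtype.val (LinearMap.congr_fun hg (B.rangeRestrict w))
      simp only [LinearMap.comp_apply, LinearMap.id_apply, LinearMap.codRestrict_apply] at this
      rw [map_sub, sub_eq_zero]
      exact this.symm
    have h3 := h _ h2
    rw [map_sub, sub_eq_zero] at h3
    rw [h3]; rfl
  rw [h1]
  exact T.le_opNorm _

/-- The previous lemma with `B` the class of `φ w` in `L²`, whose kernel consists of the `w` with `φ
w` zero almost everywhere. -/
theorem exists_sq_norm_le_integral {W E G α : Type*} [AddCommGroup W] [Module ℝ W]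
    [FiniteDimensional ℝ W] [NormedAddCommGroup E] [NormedSpace ℝ E] [NormedAddCommGroup G]
    [NormedSpace ℝ G] [MeasurableSpace α] (μ : Measure α) (A : W →ₗ[ℝ] E)
    (φ : W →ₗ[ℝ] (α → G)) (hφ : ∀ w, MemLp (φ w) 2 μ) (h : ∀ w, φ w =ᵐ[μ] 0 → A w = 0) :
    ∃ C : ℝ, 0 ≤ C ∧ ∀ w, ‖A w‖ ^ 2 ≤ C * ∫ a, ‖φ w a‖ ^ 2 ∂μ := by
  let B : W →ₗ[ℝ] Lp G 2 μ :=
    { toFun := fun w => (hφ w).toLp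
      map_add' := fun v w => by
        rw [← MemLp.toLp_add]
        exact MemLp.toLp_congr _ _ (by rw [map_add])
      map_smul' := fun c w => by
        rw [RingHom.id_apply, ← MemLp.toLp_const_smul]
        exact MemLp.toLp_congr _ _ (by rw [map_smul]) }
  obtain ⟨C, hC, hAB⟩ := exists_norm_le_of_ker_le A B fun w hw => h w <| by
    have h1 : ((hφ w).toLp : α → G) =ᵐ[μ] φ w := (hφ w).coeFn_toLp
    have h2 : (hφ w).toLp = 0 := hw
    rw [h2] at h1
    exact h1.symm.trans (Lp.coeFn_zero _ _ _)
  refine ⟨C ^ 2, sq_nonneg _, fun w => ?_⟩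
  have h1 : ‖B w‖ ^ 2 = ∫ a, ‖φ w a‖ ^ 2 ∂μ := by
    have h0 : 0 ≤ ∫ a, ‖φ w a‖ ^ 2 ∂μ := integral_nonneg fun a => sq_nonneg _
    change ‖(hφ w).toLp‖ ^ 2 = _
    rw [Lp.norm_toLp, (hφ w).eLpNorm_eq_integral_rpow_norm (by norm_num) (by norm_num)]
    simp only [ENNReal.toReal_ofNat, Real.rpow_ofNat]
    rw [ENNReal.toReal_ofReal (Real.rpow_nonneg h0 _), ← Real.rpow_natCast, ← Real.rpow_mul h0]
    norm_num
  rw [← h1, ← mul_pow]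
  exact pow_le_pow_left₀ (norm_nonneg _) (hAB w) 2

/-- The gradient on a compact set, as a linear map into continuous functions. -/
def gradOn (d k : ℕ) (K : Set (Space d)) :
    polyFun d k →ₗ[ℝ] C(K, Space d →L[ℝ] Space d) where
  toFun q := ⟨fun x => fderiv ℝ q.1 x.1,
    ((contDiff_of_mem_polyFun q.2 (n := 1)).continuous_fderiv (by norm_num)).comp
      continuous_subtype_val⟩
  map_add' p q := by
    ext1 x
    exact fderiv_add ((contDiff_of_mem_polyFun p.2 (n := 1)).differentiable (by norm_num) _)
      ((contDiff_of_mem_polyFun q.2 (n := 1)).differentiable (by norm_num) _)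
  map_smul' c q := by
    ext1 x
    exact fderiv_const_smul ((contDiff_of_mem_polyFun q.2 (n := 1)).differentiable
      (by norm_num) _) c

theorem norm_fderiv_le_norm_gradOn {d k : ℕ} {K : Set (Space d)} [CompactSpace K]
    (q : polyFun d k) {x : Space d} (hx : x ∈ K) : ‖fderiv ℝ q.1 x‖ ≤ ‖gradOn d k K q‖ :=
  (gradOn d k K q).norm_coe_le_norm ⟨x, hx⟩

theorem continuous_fderiv_polyFun {d k : ℕ} {f : Space d → Space d} (hf : f ∈ polyFun d k) :
    Continuous (fderiv ℝ f) :=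
  (contDiff_of_mem_polyFun hf (n := 1)).continuous_fderiv (by norm_num)

theorem differentiable_polyFun {d k : ℕ} {f : Space d → Space d} (hf : f ∈ polyFun d k) :
    Differentiable ℝ f :=
  (contDiff_of_mem_polyFun hf (n := 1)).differentiable (by norm_num)

/-! ### Inverse estimates for gradients on balls -/

theorem memLp_closedBall_of_continuous {m : ℕ} {G : Type*} [NormedAddCommGroup G]
    {g : Space m → G} (hg : Continuous g) (r : ℝ) :
    MemLp g 2 ((volume : Measure (Space m)).restrict (Metric.closedBall 0 r)) := by
  have hK := isCompact_closedBall (0 : Space m) r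
  obtain ⟨C, hC⟩ := hK.exists_bound_of_continuousOn hg.continuousOn
  have : IsFiniteMeasure ((volume : Measure (Space m)).restrict (Metric.closedBall 0 r)) :=
    ⟨by simpa using hK.measure_lt_top⟩
  refine MemLp.of_bound (hg.continuousOn.aestronglyMeasurable_of_isCompact hK
    Metric.isClosed_closedBall.measurableSet) C ?_
  exact (ae_restrict_iff' Metric.isClosed_closedBall.measurableSet).2 (ae_of_all _ hC)

theorem eqOn_ball_of_ae_eq {m : ℕ} {G : Type*} [NormedAddCommGroup G] {g : Space m → G}
    (hg : Continuous g) {r : ℝ}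
    (h : g =ᵐ[(volume : Measure (Space m)).restrict (Metric.closedBall 0 r)] 0) :
    ∀ x ∈ Metric.ball (0 : Space m) r, g x = 0 := by
  have h1 : g =ᵐ[(volume : Measure (Space m)).restrict (Metric.ball 0 r)] (0 : Space m → G) :=
    ae_restrict_of_ae_restrict_of_subset Metric.ball_subset_closedBall h
  exact Measure.eqOn_open_of_ae_eq h1 Metric.isOpen_ball hg.continuousOn continuousOn_const

theorem exists_fderiv_sq_le_unit (d k : ℕ) (R : ℝ) : ∃ C : ℝ, 0 ≤ C ∧
    ∀ f ∈ polyFun d k, ∀ x ∈ Metric.closedBall (0 : Space d) R,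
      ‖fderiv ℝ f x‖ ^ 2 ≤ C * ∫ y in Metric.closedBall (0 : Space d) 1, ‖fderiv ℝ f y‖ ^ 2 := by
  have : CompactSpace (Metric.closedBall (0 : Space d) R) :=
    isCompact_iff_compactSpace.1 (isCompact_closedBall _ _)
  let φ : polyFun d k →ₗ[ℝ] (Space d → Space d →L[ℝ] Space d) :=
    { toFun := fun q => fderiv ℝ q.1
      map_add' := fun p q => by
        ext1 x
        exact fderiv_add (differentiable_polyFun p.2 _) (differentiable_polyFun q.2 _)
      map_smul' := fun c q => by
        ext1 x
        exact fderiv_const_smul (differentiable_polyFun q.2 _) c }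
  obtain ⟨C, hC, h⟩ := exists_sq_norm_le_integral
    (E := C(Metric.closedBall (0 : Space d) R, Space d →L[ℝ] Space d))
    ((volume : Measure (Space d)).restrict (Metric.closedBall 0 1))
    (gradOn d k (Metric.closedBall (0 : Space d) R)) φ
    (fun q => memLp_closedBall_of_continuous (continuous_fderiv_polyFun q.2) 1)
    -- The gradient is analytic, so vanishing on the open unit ball makes it vanish everywhere.
    (fun q hq => by
      have h1 := eqOn_ball_of_ae_eq (continuous_fderiv_polyFun q.2) hq
      have h2 : fderiv ℝ q.1 = 0 := by
        refine (analyticOnNhd_of_mem_polyFun q.2).fderiv.eq_of_eventuallyEq (z₀ := 0)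
          (analyticOnNhd_const (v := (0 : Space d →L[ℝ] Space d))) ?_
        filter_upwards [Metric.ball_mem_nhds (0 : Space d) one_pos] with x hx using h1 x hx
      ext1 x
      exact congrFun h2 x.1)
  refine ⟨C, hC, fun f hf x hx => le_trans ?_ (h ⟨f, hf⟩)⟩
  exact pow_le_pow_left₀ (norm_nonneg _) (norm_fderiv_le_norm_gradOn ⟨f, hf⟩ hx) 2

theorem fderiv_comp_affine {d : ℕ} {f : Space d → Space d} (hf : Differentiable ℝ f)
    (c : Space d) (r : ℝ) (U : Space d ≃ₗᵢ[ℝ] Space d) (x : Space d) :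
    ‖fderiv ℝ (fun y => f (c + r • U y)) x‖ = |r| * ‖fderiv ℝ f (c + r • U x)‖ := by
  have h1 : HasFDerivAt (fun y : Space d => c + r • U y)
      (r • (U.toContinuousLinearEquiv : Space d →L[ℝ] Space d)) x :=
    ((U.toContinuousLinearEquiv.hasFDerivAt (x := x)).const_smul r).const_add c
  have h2 := ((hf (c + r • U x)).hasFDerivAt.comp x h1).fderiv
  have h3 : (fun y => f (c + r • U y)) = f ∘ fun y => c + r • U y := rfl
  rw [h3, h2, ContinuousLinearMap.comp_smul, norm_smul, Real.norm_eq_abs]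
  congr 1
  exact ContinuousLinearMap.opNorm_comp_linearIsometryEquiv _ _

theorem setIntegral_closedBall_comp_smul {d : ℕ} (g : Space d → ℝ) (c : Space d) {r : ℝ}
    (hr : 0 < r) : ∫ y in Metric.closedBall (0 : Space d) 1, g (c + r • y) =
      (r ^ d)⁻¹ * ∫ y in Metric.closedBall c r, g y := by
  have h1 := Measure.setIntegral_comp_smul_of_pos (volume : Measure (Space d))
    (fun y => g (c + y)) (Metric.closedBall (0 : Space d) 1) hr
  have h2 : r • Metric.closedBall (0 : Space d) 1 = (fun y => c + y) ⁻¹' Metric.closedBall c r := by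
    rw [smul_closedBall _ _ zero_le_one]
    ext y; simp [abs_of_pos hr, dist_eq_norm]
  rw [h1, h2, (measurePreserving_add_left volume c).setIntegral_preimage_emb
    (measurableEmbedding_addLeft c)]
  simp

/-- A pointwise bound for the gradient of a polynomial by its `L²` norm on a comparable ball. -/
theorem exists_fderiv_sq_le_closedBall (d k : ℕ) (R : ℝ) : ∃ C : ℝ, 0 ≤ C ∧
    ∀ f ∈ polyFun d k, ∀ (c : Space d) (r : ℝ), 0 < r → ∀ x ∈ Metric.closedBall c (R * r),
      ‖fderiv ℝ f x‖ ^ 2 ≤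
        C * (r ^ d)⁻¹ * ∫ y in Metric.closedBall c r, ‖fderiv ℝ f y‖ ^ 2 := by
  obtain ⟨C, hC, h⟩ := exists_fderiv_sq_le_unit d k R
  refine ⟨C, hC, fun f hf c r hr x hx => ?_⟩
  have hg := comp_affine_mem_polyFun hf c (r • LinearMap.id)
  have hn := fderiv_comp_affine (differentiable_polyFun hf) c r (LinearIsometryEquiv.refl ℝ _)
  simp only [LinearIsometryEquiv.coe_refl, id_eq, abs_of_pos hr] at hn
  have := h _ hg (r⁻¹ • (x - c)) (by
    rw [mem_closedBall_zero_iff, norm_smul, norm_inv, Real.norm_of_nonneg hr.le,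
      inv_mul_le_iff₀ hr, mul_comm]
    rwa [Metric.mem_closedBall, dist_eq_norm] at hx)
  simp only [LinearMap.smul_apply, LinearMap.id_apply, hn, mul_pow, integral_const_mul,
    smul_inv_smul₀ hr.ne', add_sub_cancel] at this
  rw [setIntegral_closedBall_comp_smul (fun y => ‖fderiv ℝ f y‖ ^ 2) c hr] at this
  -- The chain rule puts `r ^ 2` on both sides; it cancels, and only the Jacobian factor `(r ^ d)⁻¹`
  -- remains.
  have hr2 : 0 < r ^ 2 := by positivity
  nlinarith [this, mul_le_mul_iff_right₀ hr2 (b := ‖fderiv ℝ f x‖ ^ 2)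
    (c := C * (r ^ d)⁻¹ * ∫ y in Metric.closedBall c r, ‖fderiv ℝ f y‖ ^ 2)]

/-! ### Control of a polynomial by its normal derivatives on a hyperplane -/

/-- The inclusion of `ℝ^m` into `ℝ^(m+1)` as the hyperplane orthogonal to the first coordinate. -/
def hyperplaneIncl (m : ℕ) : Space m →ₗᵢ[ℝ] Space (m + 1) where
  toFun w := WithLp.toLp 2 (Fin.cons 0 fun i => w i)
  map_add' v w := by
    ext i; refine Fin.cases ?_ (fun j => ?_) i <;> simp
  map_smul' c w := by
    ext i; refine Fin.cases ?_ (fun j => ?_) i <;> simp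
  norm_map' w := by
    simp [EuclideanSpace.norm_eq, Fin.sum_univ_succ]

theorem hyperplaneIncl_add_smul {m : ℕ} (x : Space (m + 1)) :
    hyperplaneIncl m (WithLp.toLp 2 fun i => x i.succ) + x 0 • EuclideanSpace.single 0 1 = x := by
  ext i
  refine Fin.cases ?_ (fun j => ?_) i <;> simp [hyperplaneIncl]

theorem inner_single_hyperplaneIncl {m : ℕ} (w : Space m) :
    inner ℝ (EuclideanSpace.single 0 1) (hyperplaneIncl m w) = 0 := by
  simp [hyperplaneIncl, EuclideanSpace.inner_single_left]

theorem norm_tail_le {m : ℕ} (x : Space (m + 1)) :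
    ‖(WithLp.toLp 2 fun i => x i.succ : Space m)‖ ≤ ‖x‖ := by
  rw [EuclideanSpace.norm_eq, EuclideanSpace.norm_eq]
  apply Real.sqrt_le_sqrt
  rw [Fin.sum_univ_succ (f := fun i => ‖x i‖ ^ 2)]
  exact le_add_of_nonneg_left (sq_nonneg _)

theorem normalDeriv_add {d k i : ℕ} {f g : Space d → Space d} (hf : f ∈ polyFun d k)
    (hg : g ∈ polyFun d k) (n : Space d) :
    normalDeriv i n (f + g) = normalDeriv i n f + normalDeriv i n g := by
  ext1 x
  simp only [normalDeriv, Pi.add_apply]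
  rw [iteratedFDeriv_add (contDiff_of_mem_polyFun hf) (contDiff_of_mem_polyFun hg)]
  simp

theorem normalDeriv_smul {d k i : ℕ} {f : Space d → Space d} (hf : f ∈ polyFun d k) (c : ℝ)
    (n : Space d) : normalDeriv i n (c • f) = c • normalDeriv i n f := by
  ext1 x
  simp only [normalDeriv, Pi.smul_apply]
  rw [iteratedFDeriv_const_smul_apply (contDiff_of_mem_polyFun hf).contDiffAt,
    _root_.smul_apply, smul_comm]

theorem continuous_normalDeriv {d k i : ℕ} {f : Space d → Space d} (hf : f ∈ polyFun d k)
    (n : Space d) : Continuous (normalDeriv i n f) := by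
  have h : Continuous (iteratedFDeriv ℝ i f) :=
    (contDiff_of_mem_polyFun hf (n := i)).continuous_iteratedFDeriv le_rfl
  unfold normalDeriv
  fun_prop

theorem exists_fderiv_sq_le_normalDeriv_unit (m k : ℕ) (R : ℝ) : ∃ C : ℝ, 0 ≤ C ∧
    ∀ f ∈ polyFun (m + 1) k, ∀ x ∈ Metric.closedBall (0 : Space (m + 1)) R,
      ‖fderiv ℝ f x‖ ^ 2 ≤ C * ∑ i ∈ Finset.range (k + 1),
        ∫ w in Metric.closedBall (0 : Space m) 1,
          ‖normalDeriv i (EuclideanSpace.single 0 1) f (hyperplaneIncl m w)‖ ^ 2 := by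
  have : CompactSpace (Metric.closedBall (0 : Space (m + 1)) R) :=
    isCompact_iff_compactSpace.1 (isCompact_closedBall _ _)
  let e : Space (m + 1) := EuclideanSpace.single 0 1
  let φ : polyFun (m + 1) k →ₗ[ℝ] (Space m → Fin (k + 1) → Space (m + 1)) :=
    { toFun := fun q w i => normalDeriv i e q.1 (hyperplaneIncl m w)
      map_add' := fun p q => by
        ext1 w; ext1 i
        exact congrFun (normalDeriv_add p.2 q.2 e) _
      map_smul' := fun c q => by
        ext1 w; ext1 i
        exact congrFun (normalDeriv_smul q.2 c e) _ }
  have hc : ∀ q : polyFun (m + 1) k, ∀ i, Continuous fun w =>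
      normalDeriv i e q.1 (hyperplaneIncl m w) := fun q i =>
    (continuous_normalDeriv q.2 e).comp (hyperplaneIncl m).continuous
  have hφc : ∀ q, Continuous (φ q) := fun q => continuous_pi fun i => hc q i
  obtain ⟨C, hC, h⟩ := exists_sq_norm_le_integral
    (E := C(Metric.closedBall (0 : Space (m + 1)) R, Space (m + 1) →L[ℝ] Space (m + 1)))
    ((volume : Measure (Space m)).restrict (Metric.closedBall 0 1))
    (gradOn (m + 1) k (Metric.closedBall (0 : Space (m + 1)) R)) φ
    (fun q => memLp_closedBall_of_continuous (hφc q) 1)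
    (fun q hq => by
      have h1 := eqOn_ball_of_ae_eq (hφc q) hq
      -- Each point of the open unit ball lies on a normal line through the open unit disc, where
      -- all normal derivatives vanish; analyticity does the rest.
      have h2 : q.1 = 0 := by
        refine (analyticOnNhd_of_mem_polyFun q.2).eq_of_eventuallyEq (z₀ := 0)
          (analyticOnNhd_const (v := (0 : Space (m + 1)))) ?_
        filter_upwards [Metric.ball_mem_nhds (0 : Space (m + 1)) one_pos] with x hx
        rw [← hyperplaneIncl_add_smul x]
        refine eq_zero_on_line q.2 _ _ (fun i hi => ?_) _
        exact congrFun (h1 _ (mem_ball_zero_iff.2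
          ((norm_tail_le x).trans_lt (mem_ball_zero_iff.1 hx)))) ⟨i, Nat.lt_succ_of_le hi⟩
      have h3 : q = 0 := Subtype.ext h2
      rw [h3, map_zero])
  refine ⟨C, hC, fun f hf x hx => le_trans ?_ ((h ⟨f, hf⟩).trans ?_)⟩
  · exact pow_le_pow_left₀ (norm_nonneg _) (norm_fderiv_le_norm_gradOn ⟨f, hf⟩ hx) 2
  · refine mul_le_mul_of_nonneg_left ?_ hC
    have hi : ∀ i, IntegrableOn (fun w => ‖normalDeriv i e f (hyperplaneIncl m w)‖ ^ 2)
        (Metric.closedBall (0 : Space m) 1) := fun i =>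
      ((hc ⟨f, hf⟩ i).norm.pow 2).continuousOn.integrableOn_compact (isCompact_closedBall _ _)
    rw [← integral_finsetSum _ fun i _ => hi i]
    refine integral_mono
      (((hφc ⟨f, hf⟩).norm.pow 2).continuousOn.integrableOn_compact (isCompact_closedBall _ _))
      (integrable_finsetSum _ fun i _ => hi i) fun w => ?_
    beta_reduce
    rw [Finset.sum_range]
    have h0 : 0 ≤ ∑ i : Fin (k + 1), ‖normalDeriv i e f (hyperplaneIncl m w)‖ ^ 2 :=
      Finset.sum_nonneg fun i _ => sq_nonneg _
    -- The family over `i` carries the sup norm, whose square is at most the sum of the squares.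
    rw [← Real.sqrt_le_sqrt_iff h0, Real.sqrt_sq (norm_nonneg _)]
    refine (pi_norm_le_iff_of_nonneg (Real.sqrt_nonneg _)).2 fun i => ?_
    apply Real.le_sqrt_of_sq_le
    exact Finset.single_le_sum (f := fun i : Fin (k + 1) =>
      ‖normalDeriv i e f (hyperplaneIncl m w)‖ ^ 2) (fun i _ => sq_nonneg _) (Finset.mem_univ i)

theorem exists_isometry_single {m : ℕ} {n : Space (m + 1)} (hn : ‖n‖ = 1) :
    ∃ U : Space (m + 1) ≃ₗᵢ[ℝ] Space (m + 1), U (EuclideanSpace.single 0 1) = n := by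
  have ho : Orthonormal ℝ (({0} : Set (Fin (m + 1))).domRestrict fun _ => n) := by
    refine ⟨fun i => hn, fun i j hij => (hij ?_).elim⟩
    exact Subtype.ext (i.2.trans j.2.symm)
  obtain ⟨b, hb⟩ := ho.exists_orthonormalBasis_extension_of_card_eq (by simp)
  refine ⟨b.repr.symm, ?_⟩
  rw [OrthonormalBasis.repr_symm_single, hb 0 rfl]

theorem integrableOn_of_subset_isCompact {X : Type*} [TopologicalSpace X] [T2Space X]
    [MeasurableSpace X] [OpensMeasurableSpace X] {μ : Measure X}
    {S K : Set X} (hK : IsCompact K) (hSK : S ⊆ K) (hμ : μ S ≠ ⊤) {f : X → ℝ}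
    (hf : Continuous f) : IntegrableOn f S μ := by
  obtain ⟨C, hC⟩ := hK.exists_bound_of_continuousOn hf.continuousOn
  have : IsFiniteMeasure (μ.restrict S) := ⟨by simpa using hμ.lt_top⟩
  refine Integrable.mono' (integrable_const C) ?_ ?_
  · exact hf.stronglyMeasurable.aestronglyMeasurable
  · exact ae_mono (Measure.restrict_mono_set μ hSK)
      ((ae_restrict_iff' hK.isClosed.measurableSet).2 (ae_of_all _ hC))

theorem normalDeriv_comp_affine {d k : ℕ} {f : Space d → Space d} (hf : f ∈ polyFun d k) (i : ℕ)
    (c : Space d) (r : ℝ) (U : Space d ≃ₗᵢ[ℝ] Space d) (e x : Space d) :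
    normalDeriv i e (fun y => f (c + r • U y)) x =
      r ^ i • normalDeriv i (U e) f (c + r • U x) := by
  have hf' : ContDiff ℝ ∞ f := contDiff_of_mem_polyFun hf
  have hg : ContDiff ℝ ∞ (fun y => f (c + r • U y)) :=
    hf'.comp (contDiff_const.add (U.contDiff.const_smul r))
  have hl : ContDiff ℝ ∞ (fun t : ℝ => f (c + r • U x + t • U e)) :=
    hf'.comp (contDiff_const.add (contDiff_id.smul contDiff_const))
  rw [normalDeriv_eq_line hg, normalDeriv_eq_line hf', smul_comm]
  congr 1
  have h := congrFun (iteratedDeriv_comp_const_smul (n := i)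
    (hl.of_le (by exact_mod_cast le_top)) r) 0
  rw [mul_zero] at h
  rw [← h]
  congr 1
  ext1 t
  rw [map_add, map_smul, smul_add, smul_smul, add_assoc]

/-- The affine isometry `ψ` carries Lebesgue measure on `ℝ^m` to the normalized Hausdorff measure on
the hyperplane through `c`. The image of the disc lies in `D`, and `g` is nonnegative. -/
theorem setIntegral_disc_le {m : ℕ} {g : Space (m + 1) → ℝ} (hg : Continuous g)
    (hg0 : ∀ x, 0 ≤ g x) {n : Space (m + 1)} {U : Space (m + 1) ≃ₗᵢ[ℝ] Space (m + 1)}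
    (hU : U (EuclideanSpace.single 0 1) = n) (c : Space (m + 1)) {r : ℝ} (hr : 0 < r)
    {D : Set (Space (m + 1))} (hD : IsCompact D) (hμ : μHE[m] D ≠ ⊤)
    (hcD : ∀ w, inner ℝ n w = 0 → ‖w‖ ≤ r → c + w ∈ D) :
    ∫ w in Metric.closedBall (0 : Space m) 1, g (c + r • U (hyperplaneIncl m w)) ≤
      (r ^ m)⁻¹ * ∫ x in D, g x ∂μHE[m] := by
  have h1 := setIntegral_closedBall_comp_smul (fun w => g (c + U (hyperplaneIncl m w))) 0 hr
  simp only [zero_add, map_smul] at h1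
  rw [h1]
  refine mul_le_mul_of_nonneg_left ?_ (by positivity)
  let ψ : Space m → Space (m + 1) := fun w => c + U (hyperplaneIncl m w)
  have hψ : Isometry ψ := fun v w => by
    simp only [ψ, edist_add_left]
    exact (U.isometry.comp (hyperplaneIncl m).isometry) v w
  have hme : MeasurableEmbedding ψ := hψ.isClosedEmbedding.measurableEmbedding
  have hmap : Measure.map ψ volume = μHE[m].restrict (Set.range ψ) := by
    rw [← EuclideanSpace.euclideanHausdorffMeasure_eq_volume, hψ.map_euclideanHausdorffMeasure]
  have hpre : ψ ⁻¹' (ψ '' Metric.closedBall 0 r) = Metric.closedBall 0 r :=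
    hψ.injective.preimage_image _
  have h2 := hme.setIntegral_map (μ := volume) g (ψ '' Metric.closedBall 0 r)
  rw [hpre, hmap, Measure.restrict_restrict_of_subset (Set.image_subset_range _ _)] at h2
  rw [← h2]
  refine setIntegral_mono_set (integrableOn_of_subset_isCompact hD subset_rfl hμ hg)
    (ae_of_all _ hg0) (LE.le.eventuallyLE ?_)
  rintro _ ⟨w, hw, rfl⟩
  refine hcD _ ?_ (by simpa using hw)
  rw [← hU, U.inner_map_map, inner_single_hyperplaneIncl]

/-- A pointwise bound for the gradient of a polynomial by its normal derivatives on a plane region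
`D` containing a disc of radius `r`. -/
theorem exists_fderiv_sq_le_normalDeriv (m k : ℕ) (R : ℝ) : ∃ C : ℝ, 0 ≤ C ∧
    ∀ f ∈ polyFun (m + 1) k, ∀ n : Space (m + 1), ‖n‖ = 1 → ∀ (c : Space (m + 1)) (r : ℝ), 0 < r →
    ∀ D : Set (Space (m + 1)), IsCompact D → μHE[m] D ≠ ⊤ →
    (∀ w, inner ℝ n w = 0 → ‖w‖ ≤ r → c + w ∈ D) → ∀ x ∈ Metric.closedBall c (R * r),
      ‖fderiv ℝ f x‖ ^ 2 ≤ C * (r ^ (m + 1))⁻¹ * ∑ i ∈ Finset.range (k + 1),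
        r ^ (2 * (i : ℤ) - 1) * ∫ y in D, ‖normalDeriv i n f y‖ ^ 2 ∂μHE[m] := by
  obtain ⟨C, hC, h⟩ := exists_fderiv_sq_le_normalDeriv_unit m k R
  refine ⟨C, hC, fun f hf n hn c r hr D hD hμ hcD x hx => ?_⟩
  obtain ⟨U, hU⟩ := exists_isometry_single hn
  have hg := comp_affine_mem_polyFun hf c (r • U.toLinearEquiv.toLinearMap)
  have h1 := h _ hg (r⁻¹ • U.symm (x - c)) (by
    rw [mem_closedBall_zero_iff, norm_smul, norm_inv, Real.norm_of_nonneg hr.le,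
      inv_mul_le_iff₀ hr, mul_comm, LinearIsometryEquiv.norm_map]
    rwa [Metric.mem_closedBall, dist_eq_norm] at hx)
  have h2 : (fun x => f (c + (r • U.toLinearEquiv.toLinearMap) x)) =
    fun x => f (c + r • U x) := rfl
  rw [h2, fderiv_comp_affine (differentiable_polyFun hf)] at h1
  simp only [normalDeriv_comp_affine hf, hU, map_smul, LinearIsometryEquiv.apply_symm_apply,
    smul_inv_smul₀ hr.ne', add_sub_cancel, norm_smul, mul_pow, integral_const_mul, sq_abs] at h1
  -- Order `i` contributes `r ^ (2i)` from the derivatives and `r ^ (-m)` from the disc. After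
  -- division by the `r ^ 2` of the gradient this is `r ^ (-(m+1))` times `r ^ (2i-1)`, the weight
  -- in the ghost penalty.
  have h3 : ∀ i ∈ Finset.range (k + 1), ‖r ^ i‖ ^ 2 *
      ∫ w in Metric.closedBall (0 : Space m) 1,
        ‖normalDeriv i n f (c + r • U (hyperplaneIncl m w))‖ ^ 2 ≤
      (r ^ 2 * (r ^ (m + 1))⁻¹) *
        (r ^ (2 * (i : ℤ) - 1) * ∫ y in D, ‖normalDeriv i n f y‖ ^ 2 ∂μHE[m]) := fun i _ => by
    have h4 := setIntegral_disc_le (g := fun y => ‖normalDeriv i n f y‖ ^ 2)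
      ((continuous_normalDeriv hf n).norm.pow 2) (fun _ => sq_nonneg _) hU c hr hD hμ hcD
    refine (mul_le_mul_of_nonneg_left h4 (sq_nonneg _)).trans_eq ?_
    rw [zpow_sub₀ hr.ne', zpow_mul, zpow_one, zpow_natCast, Real.norm_of_nonneg (by positivity)]
    rw [zpow_ofNat]
    field_simp
    ring
  have h5 := h1.trans (mul_le_mul_of_nonneg_left (Finset.sum_le_sum h3) hC)
  rw [← Finset.mul_sum] at h5
  have hr2 : 0 < r ^ 2 := by positivity
  refine le_of_mul_le_mul_left (h5.trans_eq ?_) hr2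
  ring

/-! ### Surface measure of pieces of Lipschitz graphs -/

theorem euclideanHausdorffMeasure_image_le {X Y : Type*} [MetricSpace X] [MeasurableSpace X]
    [BorelSpace X] [MetricSpace Y] [MeasurableSpace Y] [BorelSpace Y] {f : X → Y} {K : NNReal}
    (hf : LipschitzWith K f) (m : ℕ) (s : Set X) : μHE[m] (f '' s) ≤ (K : ENNReal) ^ m * μHE[m] s := by
  simp_rw [Measure.euclideanHausdorffMeasure_def, Measure.smul_apply]
  have := hf.hausdorffMeasure_image_le (d := m) (by positivity) s
  rw [ENNReal.rpow_natCast] at this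
  refine (smul_le_smul_of_nonneg_left this zero_le).trans_eq ?_
  rw [ENNReal.smul_def, ENNReal.smul_def, smul_eq_mul, smul_eq_mul, mul_left_comm]

/-- The volume of the unit ball. -/
def ballVolume (m : ℕ) : ℝ := (volume (Metric.ball (0 : Space m) 1)).toReal

theorem ballVolume_pos (m : ℕ) : 0 < ballVolume m :=
  ENNReal.toReal_pos (Metric.measure_ball_pos _ _ one_pos).ne' measure_ball_lt_top.ne

theorem volume_closedBall_eq (m : ℕ) (x : Space m) {r : ℝ} (hr : 0 ≤ r) :
    volume (Metric.closedBall x r) = ENNReal.ofReal (ballVolume m * r ^ m) := by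
  rw [Measure.addHaar_closedBall _ _ hr, ballVolume, mul_comm, ENNReal.ofReal_mul (by positivity),
    ENNReal.ofReal_toReal measure_ball_lt_top.ne]
  simp

/-- The graph map `Φ` over the hyperplane orthogonal to `e` is `(1 + K)`-Lipschitz. Projection does
not increase distances, so `S` lies in the image of an `m`-dimensional ball of radius `h`. -/
theorem measure_graph_le {m : ℕ} {e : Space (m + 1)} (he : ‖e‖ = 1) {K : NNReal}
    {g : Space (m + 1) → ℝ} (hg : LipschitzWith K g) {S : Set (Space (m + 1))} {h : ℝ} (hh : 0 ≤ h)
    (hS : ∀ x ∈ S, ∀ y ∈ S, dist x y ≤ h)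
    (hSg : ∀ y ∈ S, inner ℝ e y = g (y - inner ℝ e y • e)) :
    μHE[m] S ≤ ENNReal.ofReal ((1 + K) ^ m * ballVolume m * h ^ m) := by
  rcases S.eq_empty_or_nonempty with rfl | ⟨y₀, hy₀⟩
  · simp
  obtain ⟨U, hU⟩ := exists_isometry_single he
  let w : Space (m + 1) → Space m := fun y => WithLp.toLp 2 fun i => U.symm y i.succ
  let Φ : Space m → Space (m + 1) := fun v =>
    U (hyperplaneIncl m v) + g (U (hyperplaneIncl m v)) • e
  have hΦ : LipschitzWith (1 + K) Φ := by
    refine LipschitzWith.of_dist_le_mul fun v v' => ?_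
    have h1 : dist (U (hyperplaneIncl m v)) (U (hyperplaneIncl m v')) = dist v v' := by
      rw [U.dist_map, (hyperplaneIncl m).dist_map]
    refine (dist_add_add_le _ _ _ _).trans ?_
    rw [h1, dist_eq_norm (_ • e), ← sub_smul, norm_smul, he, mul_one, Real.norm_eq_abs, ← Real.dist_eq]
    have := hg.dist_le_mul (U (hyperplaneIncl m v)) (U (hyperplaneIncl m v'))
    rw [h1] at this
    push_cast
    linarith
  have hy : ∀ y, U (hyperplaneIncl m (w y)) = y - inner ℝ e y • e := fun y => by
    have h1 := congrArg U (hyperplaneIncl_add_smul (U.symm y))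
    rw [map_add, map_smul, hU, U.apply_symm_apply] at h1
    rw [eq_sub_iff_add_eq]
    convert h1 using 3
    rw [← hU, LinearIsometryEquiv.inner_map_eq_flip, EuclideanSpace.inner_single_left]
    simp
  have hsub : S ⊆ Φ '' Metric.closedBall (w y₀) h := fun y hyS => by
    refine ⟨w y, ?_, ?_⟩
    · rw [Metric.mem_closedBall, dist_eq_norm]
      have h1 : w y - w y₀ = WithLp.toLp 2 fun i => U.symm (y - y₀) (Fin.succ i) := by
        ext i; simp [w]
      rw [h1]
      refine (norm_tail_le _).trans ?_
      rw [LinearIsometryEquiv.norm_map, ← dist_eq_norm]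
      exact hS y hyS y₀ hy₀
    · simp only [Φ, hy, ← hSg y hyS, sub_add_cancel]
  refine (measure_mono hsub).trans ((euclideanHausdorffMeasure_image_le hΦ m _).trans_eq ?_)
  have hK : (0 : ℝ) ≤ 1 + K := add_nonneg zero_le_one K.2
  rw [EuclideanSpace.euclideanHausdorffMeasure_eq_volume, volume_closedBall_eq _ _ hh, mul_assoc,
    ENNReal.ofReal_mul (pow_nonneg hK m), ENNReal.ofReal_pow hK,
    ENNReal.ofReal_eq_coe_nnreal hK]
  rfl

theorem measure_plane_le {m : ℕ} {e : Space (m + 1)} (he : ‖e‖ = 1) {a : ℝ}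
    {S : Set (Space (m + 1))} {h : ℝ} (hh : 0 ≤ h) (hS : ∀ x ∈ S, ∀ y ∈ S, dist x y ≤ h)
    (hSa : ∀ y ∈ S, inner ℝ e y = a) :
    μHE[m] S ≤ ENNReal.ofReal (ballVolume m * h ^ m) := by
  simpa using measure_graph_le he (LipschitzWith.const a) hh hS hSa

/-- Upper Ahlfors regularity of a Lipschitz boundary. -/
theorem exists_measure_frontier_inter_le {m : ℕ} {Ω : Set (Space (m + 1))} (hΩ : IsOpen Ω)
    (hb : Bornology.IsBounded Ω) (hl : HasLipschitzBoundary Ω) :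
    ∃ C : ℝ, 0 ≤ C ∧ ∀ (S : Set (Space (m + 1))) (h : ℝ), 0 ≤ h →
      (∀ x ∈ S, ∀ y ∈ S, dist x y ≤ h) →
      μHE[m] (frontier Ω ∩ S) ≤ ENNReal.ofReal (C * h ^ m) := by
  have hc : IsCompact (frontier Ω) :=
    Metric.isCompact_of_isClosed_isBounded isClosed_frontier
      (hb.closure.subset frontier_subset_closure)
  -- The bound passes to subsets and finite unions, so by compactness of the frontier it suffices to
  -- prove it near each point.
  refine hc.induction_on (p := fun A => ∃ C : ℝ, 0 ≤ C ∧ ∀ (S : Set (Space (m + 1))) (h : ℝ),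
    0 ≤ h → (∀ x ∈ S, ∀ y ∈ S, dist x y ≤ h) → μHE[m] (A ∩ S) ≤ ENNReal.ofReal (C * h ^ m))
    ?_ ?_ ?_ ?_
  · exact ⟨0, le_rfl, fun S h _ _ => by simp⟩
  · rintro A B hAB ⟨C, hC, H⟩
    exact ⟨C, hC, fun S h hh hS =>
      (measure_mono (Set.inter_subset_inter_left S hAB)).trans (H S h hh hS)⟩
  · rintro A B ⟨C, hC, H⟩ ⟨C', hC', H'⟩
    refine ⟨C + C', add_nonneg hC hC', fun S h hh hS => ?_⟩
    rw [Set.union_inter_distrib_right, add_mul, ENNReal.ofReal_add (by positivity) (by positivity)]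
    exact (measure_union_le _ _).trans (add_le_add (H S h hh hS) (H' S h hh hS))
  · intro x hx
    obtain ⟨r, hr, e, he, K, g, hg, hΩg⟩ := hl x hx
    refine ⟨frontier Ω ∩ Metric.ball x r,
      Filter.inter_mem self_mem_nhdsWithin (mem_nhdsWithin_of_mem_nhds (Metric.ball_mem_nhds x hr)),
      (1 + K) ^ m * ballVolume m, mul_nonneg (by positivity) (ballVolume_pos m).le,
      fun S h hh hS => ?_⟩
    refine measure_graph_le he hg hh (fun y hy z hz => hS y hy.2 z hz.2) ?_
    rintro y ⟨⟨hy, hyr⟩, -⟩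
    rw [hΩ.frontier_eq] at hy
    -- A frontier point is on the graph: strictly above it the point would belong to the open set
    -- `Ω`, strictly below it a whole neighbourhood would miss `Ω`.
    refine le_antisymm (not_lt.1 fun h => hy.2 ((hΩg y hyr).2 h)) (not_lt.1 fun hlt => ?_)
    have hcont : Continuous fun z : Space (m + 1) => g (z - inner ℝ e z • e) - inner ℝ e z := by
      have := hg.continuous
      fun_prop
    have ho : ∀ᶠ z in 𝓝 y, z ∈ Metric.ball x r ∧ 0 < g (z - inner ℝ e z • e) - inner ℝ e z :=
      Filter.Eventually.and (Metric.isOpen_ball.mem_nhds hyr)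
        (hcont.continuousAt.eventually (lt_mem_nhds (sub_pos.2 hlt)))
    obtain ⟨z, ⟨hzr, hz⟩, hzΩ⟩ := mem_closure_iff_nhds.1 hy.1 _ ho
    have := (hΩg z hzr).1 hzΩ
    linarith

/-! ### Geometry of simplices and meshes -/

theorem isCompact_cell {d : ℕ} (T : Finset (Space d)) : IsCompact (cell T) :=
  T.finite_toSet.isCompact_convexHull ℝ

theorem measurableSet_cell {d : ℕ} (T : Finset (Space d)) : MeasurableSet (cell T) :=
  (isCompact_cell T).isClosed.measurableSet

theorem convex_cell {d : ℕ} (T : Finset (Space d)) : Convex ℝ (cell T) := convex_convexHull ℝ _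

theorem dist_le_diam_cell {d : ℕ} {T : Finset (Space d)} {x y : Space d} (hx : x ∈ cell T)
    (hy : y ∈ cell T) : dist x y ≤ Metric.diam (cell T) :=
  Metric.dist_le_diam_of_mem (isCompact_cell T).isBounded hx hy

theorem closure_interior_cell {d : ℕ} {T : Finset (Space d)} (h : (interior (cell T)).Nonempty) :
    cell T ⊆ closure (interior (cell T)) := by
  rw [(convex_cell T).closure_interior_eq_closure_of_nonempty_interior h]
  exact subset_closure

theorem finrank_vectorSpan_finset_le {d n : ℕ} {S : Finset (Space d)} (h : S.card = n + 1) :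
    Module.finrank ℝ (vectorSpan ℝ (S : Set (Space d))) ≤ n := by
  classical
  have := finrank_vectorSpan_image_finset_le ℝ (fun x : Space d => x) S h
  rwa [Finset.image_id'] at this

theorem interior_convexHull_eq_empty {d : ℕ} {S : Finset (Space d)} (h : S.card ≤ d) :
    interior (convexHull ℝ (S : Set (Space d))) = ∅ := by
  rw [← Set.not_nonempty_iff_eq_empty]
  intro hne
  rcases S.eq_empty_or_nonempty with rfl | hS
  · simp at hne
  obtain ⟨n, hn⟩ := Nat.exists_eq_add_of_le' (Nat.succ_le_of_lt hS.card_pos)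
  have h1 := interior_convexHull_nonempty_iff_affineSpan_eq_top.1 hne
  have h2 := finrank_vectorSpan_finset_le hn
  rw [← direction_affineSpan, h1, AffineSubspace.direction_top, finrank_top,
    finrank_euclideanSpace, Fintype.card_fin] at h2
  omega

/-- Every simplex is the cone over each of its faces: a face contains a disc as large as a ball
contained in the simplex. -/
theorem exists_disc_of_ball {d : ℕ} {S : Set (Space d)} (hS : S.Nonempty) {a n c : Space d}
    {r a₀ : ℝ} (hr : 0 < r) (hc : Metric.closedBall c r ⊆ convexHull ℝ (insert a S))
    (hn : ‖n‖ = 1) (hna : ∀ y ∈ convexHull ℝ S, inner ℝ n y = a₀) :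
    ∃ y ∈ convexHull ℝ S, ∀ w, inner ℝ n w = 0 → ‖w‖ ≤ r → y + w ∈ convexHull ℝ S := by
  set η : ℝ := inner ℝ n a - a₀ with hη
  -- Cone coordinates: `s` is the weight of the apex `a`, and the height of the point over the plane
  -- of the face is `s * η`.
  have hdec : ∀ x ∈ Metric.closedBall c r, ∃ s : ℝ, 0 ≤ s ∧ s ≤ 1 ∧ ∃ y ∈ convexHull ℝ S,
      x = s • a + (1 - s) • y ∧ inner ℝ n x - a₀ = s * η := fun x hx => by
    have h1 := hc hx
    rw [convexHull_insert hS, mem_convexJoin] at h1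
    obtain ⟨_, rfl, y, hy, s, t, hs, ht, hst, rfl⟩ := h1
    obtain rfl : t = 1 - s := by linarith
    refine ⟨s, hs, by linarith, y, hy, rfl, ?_⟩
    rw [inner_add_right, inner_smul_right, inner_smul_right, hna y hy, hη]
    ring
  have hnn : inner ℝ n n = (1 : ℝ) := by rw [real_inner_self_eq_norm_sq, hn]; norm_num
  have hmem : ∀ w : Space d, ‖w‖ ≤ r → c + w ∈ Metric.closedBall c r := fun w hw => by simpa using hw
  obtain ⟨s, hs0, hs1, y, hy, hcs, hns⟩ := hdec c (Metric.mem_closedBall_self hr.le)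
  obtain ⟨s₁, hs₁0, hs₁1, -, -, -, hns₁⟩ := hdec (c + r • n)
    (hmem _ (by rw [norm_smul, hn, Real.norm_of_nonneg hr.le, mul_one]))
  obtain ⟨s₂, hs₂0, hs₂1, -, -, -, hns₂⟩ := hdec (c + (-r) • n)
    (hmem _ (by rw [norm_smul, hn, norm_neg, Real.norm_of_nonneg hr.le, mul_one]))
  rw [inner_add_right, inner_smul_right, hnn] at hns₁ hns₂
  have hη0 : η ≠ 0 := by
    rintro h0
    rw [h0] at hns hns₁
    linarith
  -- If the centre were the apex, moving by `r` along `n` or `-n` would exceed the maximal height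
  -- `|η|` on one side.
  have hs : s < 1 := by
    refine lt_of_le_of_ne hs1 fun h1 => ?_
    subst h1
    have e1 : (s₁ - 1) * η = r := by linarith
    have e2 : (s₂ - 1) * η = -r := by linarith
    rcases lt_or_gt_of_ne hη0 with h | h <;> nlinarith
  have hs' : 0 < 1 - s := by linarith
  refine ⟨y, hy, fun w hw hwr => ?_⟩
  -- Moving parallel to the face keeps the height, hence the apex weight. Projecting from `a`
  -- therefore turns the displacement `(1 - s) • w` into `w`.
  obtain ⟨s₃, hs₃0, hs₃1, z, hz, hcz, hnz⟩ := hdec (c + (1 - s) • w) (hmem _ (by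
    rw [norm_smul, Real.norm_of_nonneg hs'.le]
    nlinarith [norm_nonneg w]))
  rw [inner_add_right, inner_smul_right, hw] at hnz
  have h3 : s₃ = s := mul_right_cancel₀ hη0 (by linarith)
  rw [h3, hcs, add_assoc, ← smul_add] at hcz
  rw [smul_right_injective _ hs'.ne' (add_left_cancel hcz)]
  exact hz

namespace Mesh

variable {d : ℕ} {M : Mesh d} {Ω : Set (Space d)}

/-- By conformity the intersection lies in the hull of the common vertices. Distinct elements share
at most `d` of their `d + 1` vertices, too few for an interior. -/
theorem interior_cell_inter_eq_empty {T T' : Finset (Space d)} (hT : T ∈ M.elements)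
    (hT' : T' ∈ M.elements) (hne : T ≠ T') : interior (cell T) ∩ interior (cell T') = ∅ := by
  classical
  rw [← interior_inter]
  have h1 := M.conforming T hT T' hT'
  rw [← Finset.coe_inter] at h1
  have hcard : (T ∩ T').card ≤ d := by
    by_contra! hcon
    have h2 : T ∩ T' = T := Finset.eq_of_subset_of_card_le Finset.inter_subset_left
      (by rw [M.card T hT]; exact hcon)
    have h3 : T ∩ T' = T' := Finset.eq_of_subset_of_card_le Finset.inter_subset_right
      (by rw [M.card T' hT']; exact hcon)
    exact hne (h2.symm.trans h3)
  exact Set.subset_eq_empty (interior_mono h1) (interior_convexHull_eq_empty hcard)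

theorem diam_le_size {T : Finset (Space d)} (hT : T ∈ M.elements) :
    Metric.diam (cell T) ≤ M.size :=
  le_ciSup (f := fun T : M.elements => Metric.diam (cell (T : Finset (Space d))))
    (Set.finite_range _).bddAbove ⟨T, hT⟩

theorem dist_le_size {T : Finset (Space d)} (hT : T ∈ M.elements) {x y : Space d}
    (hx : x ∈ cell T) (hy : y ∈ cell T) : dist x y ≤ M.size :=
  (dist_le_diam_cell hx hy).trans (diam_le_size hT)

theorem size_nonneg : 0 ≤ M.size := Real.iSup_nonneg fun _ => Metric.diam_nonneg

theorem mem_active {T : Finset (Space d)} :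
    T ∈ M.active Ω ↔ T ∈ M.elements ∧ (cell T ∩ Ω).Nonempty := by
  simp [active]

theorem mem_cut {T : Finset (Space d)} :
    T ∈ M.cut Ω ↔ T ∈ M.active Ω ∧ (cell T ∩ frontier Ω).Nonempty := by
  simp [cut]

/-- The connected cell avoids the frontier and meets `Ω`, so it cannot also reach the exterior. -/
theorem cell_subset_of_notMem_cut (hΩ : IsOpen Ω) {T : Finset (Space d)} (hT : T ∈ M.active Ω)
    (hc : T ∉ M.cut Ω) : cell T ⊆ Ω := by
  have hdisj : ∀ x ∈ cell T, x ∉ frontier Ω := fun x hx hf => hc (mem_cut.2 ⟨hT, x, hx, hf⟩)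
  refine (convex_cell T).isPreconnected.subset_left_of_subset_union hΩ
    isClosed_closure.isOpen_compl
    (Set.disjoint_left.2 fun x hx hx' => hx' (subset_closure hx)) (fun x hx => ?_)
    (mem_active.1 hT).2
  by_cases h : x ∈ Ω
  · exact Or.inl h
  · refine Or.inr fun hcl => hdisj x hx ?_
    rw [hΩ.frontier_eq]
    exact ⟨hcl, h⟩

/-- The ratio of the mesh size to the radius of balls contained in the elements. -/
def shapeConst (σ ρ : ℝ) : ℝ := 2 * |ρ| * |σ| + 1

theorem shapeConst_pos (σ ρ : ℝ) : 0 < shapeConst σ ρ := by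
  unfold shapeConst; positivity

theorem one_le_shapeConst (σ ρ : ℝ) : 1 ≤ shapeConst σ ρ := by
  have : 0 ≤ 2 * |ρ| * |σ| := by positivity
  unfold shapeConst; linarith

/-- With `r` the radius from shape regularity, `h ≤ |ρ| diam T ≤ 2 |ρ| |σ| r`. All later local
estimates see the mesh only through the ball of radius `h / κ`, `κ = shapeConst σ ρ`. -/
theorem exists_closedBall_subset {m : ℕ} {M : Mesh (m + 1)} {Ω : Set (Space (m + 1))} {σ ρ : ℝ}
    (hS : M.ShapeRegular σ) (hQ : M.QuasiUniform Ω ρ) {T : Finset (Space (m + 1))}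
    (hT : T ∈ M.active Ω) : 0 < M.size ∧ M.size / shapeConst σ ρ ≤ Metric.diam (cell T) ∧
      ∃ c, Metric.closedBall c (M.size / shapeConst σ ρ) ⊆ cell T := by
  obtain ⟨c, r, hr, hc, hd⟩ := hS T (mem_active.1 hT).1
  have hq := hQ T hT
  have hdr : r ≤ Metric.diam (cell T) := by
    have h1 : c + r • EuclideanSpace.single 0 1 ∈ cell T := hc (by simp [norm_smul, abs_of_pos hr])
    have h2 : c ∈ cell T := hc (Metric.mem_closedBall_self hr.le)
    simpa [norm_smul, abs_of_pos hr] using dist_le_diam_cell h1 h2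
  have hsz := diam_le_size (mem_active.1 hT).1
  have h1 : M.size ≤ |ρ| * (|σ| * (2 * r)) := by
    refine hq.trans ((mul_le_mul_of_nonneg_right (le_abs_self ρ) Metric.diam_nonneg).trans ?_)
    refine mul_le_mul_of_nonneg_left (hd.trans ?_) (abs_nonneg _)
    exact mul_le_mul_of_nonneg_right (le_abs_self σ) (by positivity)
  have h2 : M.size / shapeConst σ ρ ≤ r := by
    rw [div_le_iff₀ (shapeConst_pos σ ρ), shapeConst]
    nlinarith
  exact ⟨by linarith, h2.trans hdr, c, (Metric.closedBall_subset_closedBall h2).trans hc⟩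

open Classical in
/-- The number of active elements meeting a given one is bounded. -/
theorem card_neighbors_le {m : ℕ} {M : Mesh (m + 1)} {Ω : Set (Space (m + 1))} {σ ρ : ℝ}
    (hS : M.ShapeRegular σ) (hQ : M.QuasiUniform Ω ρ) {T : Finset (Space (m + 1))}
    (hT : T ∈ M.active Ω) :
    (((M.active Ω).filter fun T' => (cell T ∩ cell T').Nonempty).card : ℝ) ≤
      (2 * shapeConst σ ρ) ^ (m + 1) := by
  set κ := shapeConst σ ρ
  have hκ : 0 < κ := shapeConst_pos σ ρ
  set A := (M.active Ω).filter fun T' => (cell T ∩ cell T').Nonempty with hA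
  obtain ⟨hh, -, c₀, hc₀⟩ := exists_closedBall_subset hS hQ hT
  have hε : 0 < M.size / κ := by positivity
  have hx₀ : c₀ ∈ cell T := hc₀ (Metric.mem_closedBall_self hε.le)
  have hch : ∀ T' : Finset (Space (m + 1)), ∃ c, T' ∈ M.active Ω →
      Metric.closedBall c (M.size / κ) ⊆ cell T' := fun T' => by
    by_cases h : T' ∈ M.active Ω
    · obtain ⟨-, -, c, hc⟩ := exists_closedBall_subset hS hQ h
      exact ⟨c, fun _ => hc⟩
    · exact ⟨0, fun h' => absurd h' h⟩
  choose c hc using hch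
  have hAa : ∀ T' ∈ A, T' ∈ M.active Ω := fun T' h => (Finset.mem_filter.1 h).1
  have hint : ∀ T' ∈ A, Metric.ball (c T') (M.size / κ) ⊆ interior (cell T') := fun T' h =>
    interior_maximal (Metric.ball_subset_closedBall.trans (hc T' (hAa T' h))) Metric.isOpen_ball
  have hdisj : (A : Set (Finset (Space (m + 1)))).PairwiseDisjoint
      fun T' => Metric.ball (c T') (M.size / κ) := fun T₁ h₁ T₂ h₂ hne => by
    refine Set.disjoint_left.2 fun x hx₁ hx₂ => ?_
    have := interior_cell_inter_eq_empty (mem_active.1 (hAa T₁ h₁)).1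
      (mem_active.1 (hAa T₂ h₂)).1 hne
    exact Set.notMem_empty x (this ▸ ⟨hint T₁ h₁ hx₁, hint T₂ h₂ hx₂⟩)
  -- Packing: disjoint balls of radius `h / κ` inside one of radius `2h` number at most `(2κ) ^ (m +
  -- 1)`.
  have hsub : (⋃ T' ∈ A, Metric.ball (c T') (M.size / κ)) ⊆
      Metric.closedBall c₀ (2 * M.size) := by
    refine Set.iUnion₂_subset fun T' h x hx => ?_
    obtain ⟨z, hz, hz'⟩ := (Finset.mem_filter.1 h).2
    have h1 := dist_le_size (mem_active.1 hT).1 hz hx₀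
    have h2 := dist_le_size (mem_active.1 (hAa T' h)).1 (interior_subset (hint T' h hx)) hz'
    rw [Metric.mem_closedBall]
    linarith [dist_triangle x z c₀]
  have hv := measure_mono (μ := volume) hsub
  rw [measure_biUnion_finset hdisj fun _ _ => Metric.isOpen_ball.measurableSet] at hv
  have hb : ∀ T', volume (Metric.ball (c T') (M.size / κ)) =
      ENNReal.ofReal (ballVolume (m + 1) * (M.size / κ) ^ (m + 1)) := fun T' => by
    rw [← volume_closedBall_eq _ (c T') hε.le, Measure.addHaar_closedBall_eq_addHaar_ball]
  simp only [hb, Finset.sum_const, nsmul_eq_mul] at hv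
  rw [volume_closedBall_eq _ _ (by positivity), ← ENNReal.ofReal_natCast,
    ← ENNReal.ofReal_mul (Nat.cast_nonneg _)] at hv
  have hω := ballVolume_pos (m + 1)
  rw [ENNReal.ofReal_le_ofReal_iff (by positivity)] at hv
  have e : 2 * M.size = 2 * κ * (M.size / κ) := by field_simp
  rw [e, mul_pow (2 * κ)] at hv
  have hp : 0 < ballVolume (m + 1) * (M.size / κ) ^ (m + 1) := by positivity
  refine le_of_mul_le_mul_right (hv.trans_eq ?_) hp
  ring

theorem mem_interiorFaces {P : Finset (Space d) × Finset (Space d)} [DecidableEq (Space d)] :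
    P ∈ M.interiorFaces Ω ↔ (P.1 ∈ M.active Ω ∧ P.2 ∈ M.active Ω) ∧ P.1 ≠ P.2 ∧
      (P.1 ∩ P.2).card = d := by
  simp only [interiorFaces, Finset.mem_filter, Finset.mem_product]
  convert Iff.rfl

theorem swap_mem_interiorFaces {T T' : Finset (Space d)} (h : (T, T') ∈ M.interiorFaces Ω) :
    (T', T) ∈ M.interiorFaces Ω := by
  classical
  rw [mem_interiorFaces] at h ⊢
  simp only at h ⊢
  exact ⟨h.1.symm, h.2.1.symm, by rw [Finset.inter_comm]; exact h.2.2⟩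

/-- An interior face lies in a hyperplane orthogonal to `n_F`, and contains a disc of radius
comparable to the mesh size. -/
theorem face_geometry {m : ℕ} {M : Mesh (m + 1)} {Ω : Set (Space (m + 1))}
    {σ ρ : ℝ} (hS : M.ShapeRegular σ) (hQ : M.QuasiUniform Ω ρ)
    {P : Finset (Space (m + 1)) × Finset (Space (m + 1))} (hP : P ∈ M.interiorFaces Ω) :
    ‖faceNormal P‖ = 1 ∧ (∃ a : ℝ, ∀ y ∈ face P, inner ℝ (faceNormal P) y = a) ∧
      ∃ y ∈ face P, ∀ w, inner ℝ (faceNormal P) w = 0 → ‖w‖ ≤ M.size / shapeConst σ ρ →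
        y + w ∈ face P := by
  classical
  obtain ⟨⟨h1, h2⟩, hne, hcard⟩ := mem_interiorFaces.1 hP
  have hF : face P = convexHull ℝ ((P.1 ∩ P.2 : Finset (Space (m + 1))) : Set (Space (m + 1))) := by
    refine Set.Subset.antisymm ?_ (Set.subset_inter (convexHull_mono ?_) (convexHull_mono ?_))
    · rw [Finset.coe_inter]
      exact M.conforming _ (mem_active.1 h1).1 _ (mem_active.1 h2).1
    · exact_mod_cast Finset.inter_subset_left
    · exact_mod_cast Finset.inter_subset_right
  set S := P.1 ∩ P.2 with hSdef
  obtain ⟨x₀, hx₀⟩ : S.Nonempty := Finset.card_pos.1 (by omega)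
  obtain ⟨a, ha, hPa⟩ : ∃ a, a ∉ S ∧ P.1 = insert a S := by
    have hsub : S ⊆ P.1 := Finset.inter_subset_left
    have : (P.1 \ S).card = 1 := by
      rw [Finset.card_sdiff_of_subset hsub, M.card _ (mem_active.1 h1).1, hcard]; omega
    obtain ⟨a, ha⟩ := Finset.card_eq_one.1 this
    have haa : a ∈ P.1 \ S := ha ▸ Finset.mem_singleton_self a
    refine ⟨a, (Finset.mem_sdiff.1 haa).2, ?_⟩
    rw [← Finset.sdiff_union_of_subset hsub, ha]; rfl
  -- The `m + 1` common vertices span directions of dimension at most `m`, so a nonzero orthogonal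
  -- vector exists; its sign is chosen to put `a` on the nonpositive side.
  have hex : ∃ n, IsFaceNormal P n := by
    have hr : Module.finrank ℝ (vectorSpan ℝ (S : Set (Space (m + 1)))) ≤ m :=
      finrank_vectorSpan_finset_le hcard
    have hne' : (vectorSpan ℝ (S : Set (Space (m + 1))))ᗮ ≠ ⊥ := fun hbot => by
      rw [Submodule.orthogonal_eq_bot_iff] at hbot
      rw [hbot, finrank_top, finrank_euclideanSpace, Fintype.card_fin] at hr
      omega
    obtain ⟨v, hv, hv0⟩ := Submodule.exists_mem_ne_zero_of_ne_bot hne'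
    have hvS : ∀ x ∈ S, ∀ y ∈ S, inner ℝ v (y - x) = 0 := fun x hx y hy => by
      rw [real_inner_comm]
      exact (Submodule.mem_orthogonal _ _).1 hv _
        (vsub_mem_vectorSpan ℝ (Finset.mem_coe.2 hy) (Finset.mem_coe.2 hx))
    have hkey : ∀ u : Space (m + 1), u ≠ 0 → (∀ x ∈ S, ∀ y ∈ S, inner ℝ u (y - x) = 0) →
        inner ℝ u (a - x₀) ≤ 0 → ∃ n, IsFaceNormal P n := fun u hu0 hu hua => by
      refine ⟨‖u‖⁻¹ • u, ?_, fun x hx1 hx2 y hy => ?_⟩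
      · rw [norm_smul, norm_inv, norm_norm, inv_mul_cancel₀ (norm_ne_zero_iff.2 hu0)]
      · have hxS : x ∈ S := Finset.mem_inter.2 ⟨hx1, hx2⟩
        rw [inner_smul_left]
        refine mul_nonpos_of_nonneg_of_nonpos (by simp) ?_
        rw [hPa, Finset.mem_insert] at hy
        rcases hy with rfl | hy
        · have e : y - x = (y - x₀) + (x₀ - x) := by abel
          rw [e, inner_add_right, hu x hxS x₀ hx₀, add_zero]
          exact hua
        · exact (hu x hxS y hy).le
    rcases le_total (inner ℝ v (a - x₀)) 0 with h | h
    · exact hkey v hv0 hvS h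
    · refine hkey (-v) (neg_ne_zero.2 hv0) (fun x hx y hy => ?_) ?_
      · rw [inner_neg_left, hvS x hx y hy, neg_zero]
      · rw [inner_neg_left]; linarith
  have hn : IsFaceNormal P (faceNormal P) := by
    rw [faceNormal, dif_pos hex]
    exact hex.choose_spec
  -- Exchanging `x` and `y` turns this inequality into equality, so the normal coordinate is
  -- constant on the face.
  have hle : ∀ x ∈ S, ∀ y ∈ S, inner ℝ (faceNormal P) y ≤ inner ℝ (faceNormal P) x :=
    fun x hx y hy => by
      have := hn.2 x (Finset.mem_inter.1 hx).1 (Finset.mem_inter.1 hx).2 y (Finset.mem_inter.1 hy).1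
      rw [inner_sub_right] at this
      linarith
  have hconst : ∀ y ∈ convexHull ℝ (S : Set (Space (m + 1))),
      inner ℝ (faceNormal P) y = inner ℝ (faceNormal P) x₀ := by
    have hcv : Convex ℝ {y : Space (m + 1) |
        inner ℝ (faceNormal P) y = inner ℝ (faceNormal P) x₀} :=
      convex_hyperplane (innerₛₗ ℝ (faceNormal P)).isLinear _
    exact fun y hy => convexHull_min
      (fun y hy => le_antisymm (hle x₀ hx₀ y hy) (hle y hy x₀ hx₀)) hcv hy
  obtain ⟨hh, -, c, hc⟩ := exists_closedBall_subset hS hQ h1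
  have hSne : (S : Set (Space (m + 1))).Nonempty := ⟨x₀, hx₀⟩
  have hc' : Metric.closedBall c (M.size / shapeConst σ ρ) ⊆
      convexHull ℝ (insert a (S : Set (Space (m + 1)))) := by
    rw [cell, hPa, Finset.coe_insert] at hc
    exact hc
  rw [hF]
  exact ⟨hn.1, ⟨_, hconst⟩,
    exists_disc_of_ball hSne (div_pos hh (shapeConst_pos σ ρ)) hc' hn.1 hconst⟩

end Mesh

/-! ### Traces of discrete functions -/

/-- A convex set with nonempty interior lies in the closure of that interior, so the limit is over a
nontrivial filter even at boundary points of the cell. -/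
theorem elemTrace_eq {d : ℕ} {X : Type*} [TopologicalSpace X] [T2Space X] [Nonempty X]
    {T : Finset (Space d)} {f g : Space d → X} (hg : Continuous g)
    (hfg : ∀ x ∈ interior (cell T), f x = g x) (hT : (interior (cell T)).Nonempty)
    {x : Space d} (hx : x ∈ cell T) : elemTrace T f x = g x := by
  have : (𝓝[interior (cell T)] x).NeBot :=
    mem_closure_iff_nhdsWithin_neBot.1 (closure_interior_cell hT hx)
  refine Filter.Tendsto.limUnder_eq ?_
  refine (hg.continuousAt.tendsto.mono_left nhdsWithin_le_nhds).congr' ?_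
  filter_upwards [self_mem_nhdsWithin] with y hy using (hfg y hy).symm

theorem Mesh.IsDiscrete.exists_polyFun {d k : ℕ} {M : Mesh d} {Ω : Set (Space d)}
    {v : Space d → Space d} (hv : M.IsDiscrete Ω k v) :
    ∃ p : Finset (Space d) → Space d → Space d, (∀ T, p T ∈ polyFun d k) ∧
      ∀ T ∈ M.active Ω, ∀ x ∈ interior (cell T), v x = p T x := by
  have h : ∀ T, ∃ q ∈ polyFun d k, T ∈ M.active Ω → ∀ x ∈ interior (cell T), v x = q x :=
    fun T => by
      by_cases hT : T ∈ M.active Ω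
      · obtain ⟨P, hP, hvP⟩ := hv T hT
        refine ⟨evalVec d P, mem_polyFun.2 ⟨P, hP, fun x i => rfl⟩, fun _ x hx => ?_⟩
        ext i
        exact hvP x hx i
      · exact ⟨0, Submodule.zero_mem _, fun h => absurd h hT⟩
  choose p hp hvp using h
  exact ⟨p, hp, hvp⟩

theorem eventuallyEq_of_interior {d : ℕ} {T : Finset (Space d)} {v q : Space d → Space d}
    (h : ∀ x ∈ interior (cell T), v x = q x)
    {x : Space d} (hx : x ∈ interior (cell T)) : v =ᶠ[𝓝 x] q :=
  Filter.eventually_of_mem (isOpen_interior.mem_nhds hx) h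

theorem fderiv_eq_of_interior {d : ℕ} {T : Finset (Space d)} {v q : Space d → Space d}
    (h : ∀ x ∈ interior (cell T), v x = q x)
    {x : Space d} (hx : x ∈ interior (cell T)) :
    fderiv ℝ v x = fderiv ℝ q x :=
  (eventuallyEq_of_interior h hx).fderiv_eq

theorem normalDeriv_eq_of_interior {d : ℕ} {T : Finset (Space d)} {v q : Space d → Space d}
    (h : ∀ x ∈ interior (cell T), v x = q x)
    (i : ℕ) (n : Space d) {x : Space d}
    (hx : x ∈ interior (cell T)) : normalDeriv i n v x = normalDeriv i n q x := by
  rw [normalDeriv, normalDeriv, ((eventuallyEq_of_interior h hx).iteratedFDeriv ℝ i).eq_of_nhds]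

/-! ### The Frobenius norm -/

theorem frob_self {d : ℕ} (A : Space d →L[ℝ] Space d) :
    frob A A = ∑ j : Fin d, ‖A (EuclideanSpace.single j 1)‖ ^ 2 := by
  simp [frob]

theorem frob_self_nonneg {d : ℕ} (A : Space d →L[ℝ] Space d) : 0 ≤ frob A A := by
  rw [frob_self]; positivity

theorem frob_self_le {d : ℕ} (A : Space d →L[ℝ] Space d) : frob A A ≤ d * ‖A‖ ^ 2 := by
  rw [frob_self]
  refine (Finset.sum_le_card_nsmul _ _ (‖A‖ ^ 2) fun j _ => ?_).trans_eq (by simp)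
  refine pow_le_pow_left₀ (norm_nonneg _) ((A.le_opNorm _).trans_eq (by simp)) 2

theorem norm_sq_le_frob {d : ℕ} (A : Space d →L[ℝ] Space d) : ‖A‖ ^ 2 ≤ frob A A := by
  rw [← Real.le_sqrt (norm_nonneg _) (frob_self_nonneg A)]
  refine A.opNorm_le_bound (Real.sqrt_nonneg _) fun x => ?_
  have hx : x = ∑ j, x j • EuclideanSpace.single j (1 : ℝ) := by
    ext l; simp [Finset.sum_apply, Pi.single_apply]
  conv_lhs => rw [hx]
  rw [map_sum]
  refine (norm_sum_le _ _).trans ?_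
  simp only [map_smul, norm_smul]
  refine (Real.sum_mul_le_sqrt_mul_sqrt _ _ _).trans_eq ?_
  rw [mul_comm, ← frob_self, ← EuclideanSpace.norm_eq]

theorem continuous_frob_fderiv {d k : ℕ} {f : Space d → Space d} (hf : f ∈ polyFun d k) :
    Continuous fun x => frob (fderiv ℝ f x) (fderiv ℝ f x) := by
  simp only [frob_self]
  have := continuous_fderiv_polyFun hf
  fun_prop

/-! ### Local estimates on a mesh -/

/-- The squared `L²` norm of the gradient on an element. -/
def cellEnergy {d : ℕ} (T : Finset (Space d)) (f : Space d → Space d) : ℝ :=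
  ∫ x in cell T, ‖fderiv ℝ f x‖ ^ 2

theorem cellEnergy_nonneg {d : ℕ} (T : Finset (Space d)) (f : Space d → Space d) :
    0 ≤ cellEnergy T f := integral_nonneg fun _ => sq_nonneg _

/-- The ghost penalty of a polynomial on a single face. -/
def facePenalty {m : ℕ} (k : ℕ) (P : Finset (Space (m + 1)) × Finset (Space (m + 1)))
    (f : Space (m + 1) → Space (m + 1)) : ℝ :=
  ∑ i ∈ Finset.range (k + 1), ∫ x in face P, faceSize P ^ (2 * (i : ℤ) - 1) *
    ‖normalDeriv i (faceNormal P) f x‖ ^ 2 ∂μHE[m]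

theorem faceSize_nonneg {d : ℕ} (P : Finset (Space d) × Finset (Space d)) : 0 ≤ faceSize P :=
  le_min Metric.diam_nonneg Metric.diam_nonneg

theorem facePenalty_nonneg {m : ℕ} (k : ℕ)
    (P : Finset (Space (m + 1)) × Finset (Space (m + 1)))
    (f : Space (m + 1) → Space (m + 1)) : 0 ≤ facePenalty k P f :=
  Finset.sum_nonneg fun _ _ => integral_nonneg fun _ =>
    mul_nonneg (zpow_nonneg (faceSize_nonneg P) _) (sq_nonneg _)

theorem isCompact_face {d : ℕ} (P : Finset (Space d) × Finset (Space d)) : IsCompact (face P) :=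
  (isCompact_cell P.1).inter (isCompact_cell P.2)

theorem continuous_norm_fderiv_sq {d k : ℕ} {f : Space d → Space d} (hf : f ∈ polyFun d k) :
    Continuous fun x => ‖fderiv ℝ f x‖ ^ 2 :=
  (continuous_fderiv_polyFun hf).norm.pow 2

theorem fderiv_sub_polyFun {d k : ℕ} {f g : Space d → Space d} (hf : f ∈ polyFun d k)
    (hg : g ∈ polyFun d k) (x : Space d) : fderiv ℝ (f - g) x = fderiv ℝ f x - fderiv ℝ g x :=
  fderiv_sub (differentiable_polyFun hf x) (differentiable_polyFun hg x)

theorem normalDeriv_sub {d k i : ℕ} {f g : Space d → Space d} (hf : f ∈ polyFun d k)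
    (hg : g ∈ polyFun d k) (n : Space d) :
    normalDeriv i n (f - g) = normalDeriv i n f - normalDeriv i n g := by
  have h := normalDeriv_add (i := i) (Submodule.sub_mem _ hf hg) hg n
  rw [sub_add_cancel] at h
  rw [h, add_sub_cancel_right]

namespace Mesh

variable {m : ℕ}

/-- The point `x` is within `(R + 1) h` of the centre of a ball of radius `h / κ` in `T`. It may lie
outside `T`, which is what carries control into a neighbouring element. -/
theorem exists_fderiv_sq_le_cellEnergy (m k : ℕ) (σ ρ R : ℝ) : ∃ C : ℝ, 0 ≤ C ∧
    ∀ (M : Mesh (m + 1)) (Ω : Set (Space (m + 1))), M.ShapeRegular σ → M.QuasiUniform Ω ρ →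
    ∀ T ∈ M.active Ω, ∀ f ∈ polyFun (m + 1) k, ∀ z ∈ cell T, ∀ x, dist x z ≤ R * M.size →
      ‖fderiv ℝ f x‖ ^ 2 ≤ C * (M.size ^ (m + 1))⁻¹ * cellEnergy T f := by
  set κ := shapeConst σ ρ
  have hκ : 0 < κ := shapeConst_pos σ ρ
  obtain ⟨C, hC, h⟩ := exists_fderiv_sq_le_closedBall (m + 1) k ((R + 1) * κ)
  refine ⟨C * κ ^ (m + 1), by positivity, fun M Ω hS hQ T hT f hf z hz x hx => ?_⟩
  obtain ⟨hh, -, c, hc⟩ := exists_closedBall_subset hS hQ hT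
  have hε : 0 < M.size / κ := by positivity
  have h1 := h f hf c _ hε x (by
    have e : (R + 1) * κ * (M.size / κ) = R * M.size + M.size := by field_simp
    rw [e, Metric.mem_closedBall]
    have h2 := dist_le_size (mem_active.1 hT).1 hz (hc (Metric.mem_closedBall_self hε.le))
    linarith [dist_triangle x z c])
  refine h1.trans ?_
  have e : (((M.size / κ) ^ (m + 1))⁻¹ : ℝ) = κ ^ (m + 1) * (M.size ^ (m + 1))⁻¹ := by
    rw [div_pow, inv_div, div_eq_mul_inv]
  rw [e, ← mul_assoc C]
  refine mul_le_mul_of_nonneg_left ?_ (by positivity)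
  exact setIntegral_mono_set
    ((continuous_norm_fderiv_sq hf).continuousOn.integrableOn_compact (isCompact_cell T))
    (ae_of_all _ fun _ => sq_nonneg _) (LE.le.eventuallyLE hc)

theorem measure_face_le {M : Mesh (m + 1)} {Ω : Set (Space (m + 1))} {σ ρ : ℝ}
    (hS : M.ShapeRegular σ) (hQ : M.QuasiUniform Ω ρ)
    {P : Finset (Space (m + 1)) × Finset (Space (m + 1))} (hP : P ∈ M.interiorFaces Ω) :
    μHE[m] (face P) ≤ ENNReal.ofReal (ballVolume m * M.size ^ m) := by
  classical
  obtain ⟨hn, ⟨a, ha⟩, -⟩ := face_geometry hS hQ hP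
  exact measure_plane_le hn size_nonneg (fun x hx y hy =>
    dist_le_size (mem_active.1 (mem_interiorFaces.1 hP).1.1).1 hx.1 hy.1) ha

theorem exists_fderiv_sq_le_facePenalty (m k : ℕ) (σ ρ R : ℝ) : ∃ C : ℝ, 0 ≤ C ∧
    ∀ (M : Mesh (m + 1)) (Ω : Set (Space (m + 1))), M.ShapeRegular σ → M.QuasiUniform Ω ρ →
    ∀ P ∈ M.interiorFaces Ω, ∀ f ∈ polyFun (m + 1) k, ∀ z ∈ face P, ∀ x,
      dist x z ≤ R * M.size →
      ‖fderiv ℝ f x‖ ^ 2 ≤ C * (M.size ^ (m + 1))⁻¹ * facePenalty k P f := by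
  classical
  set κ := shapeConst σ ρ with hκdef
  have hκ : 0 < κ := shapeConst_pos σ ρ
  have hκ1 : 1 ≤ κ := one_le_shapeConst σ ρ
  obtain ⟨C, hC, h⟩ := exists_fderiv_sq_le_normalDeriv m k ((R + 1) * κ)
  refine ⟨C * κ ^ (m + 1) * κ, by positivity, fun M Ω hS hQ P hP f hf z hz x hx => ?_⟩
  obtain ⟨⟨hT1, hT2⟩, -, -⟩ := mem_interiorFaces.1 hP
  obtain ⟨hn, -, y, hy, hyd⟩ := face_geometry hS hQ hP
  obtain ⟨hh, hd1, -⟩ := exists_closedBall_subset hS hQ hT1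
  obtain ⟨-, hd2, -⟩ := exists_closedBall_subset hS hQ hT2
  rw [← hκdef] at hyd hd1 hd2
  have hε : 0 < M.size / κ := by positivity
  have hμ : μHE[m] (face P) ≠ ⊤ := ((measure_face_le hS hQ hP).trans_lt ENNReal.ofReal_lt_top).ne
  have h1 := h f hf _ hn y _ hε (face P) (isCompact_face P) hμ hyd x (by
    have e : (R + 1) * κ * (M.size / κ) = R * M.size + M.size := by field_simp
    rw [e, Metric.mem_closedBall]
    have h2 := dist_le_size (mem_active.1 hT1).1 hz.1 hy.1
    linarith [dist_triangle x z y])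
  refine h1.trans ?_
  have e : (((M.size / κ) ^ (m + 1))⁻¹ : ℝ) = κ ^ (m + 1) * (M.size ^ (m + 1))⁻¹ := by
    rw [div_pow, inv_div, div_eq_mul_inv]
  have hfs : M.size / κ ≤ faceSize P := le_min hd1 hd2
  have hfs' : faceSize P ≤ M.size := (min_le_left _ _).trans (diam_le_size (mem_active.1 hT1).1)
  have hfs0 : 0 < faceSize P := hε.trans_le hfs
  -- Passing from the disc radius to `faceSize P`: for `i ≥ 1` the exponent is positive and the
  -- weight only grows. For `i = 0` it is `-1`, which costs the factor `κ`.
  have hsum : ∑ i ∈ Finset.range (k + 1), (M.size / κ) ^ (2 * (i : ℤ) - 1) *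
      ∫ y in face P, ‖normalDeriv i (faceNormal P) f y‖ ^ 2 ∂μHE[m] ≤ κ * facePenalty k P f := by
    rw [facePenalty, Finset.mul_sum]
    refine Finset.sum_le_sum fun i _ => ?_
    rw [integral_const_mul, ← mul_assoc]
    refine mul_le_mul_of_nonneg_right ?_ (integral_nonneg fun _ => sq_nonneg _)
    rcases Nat.eq_zero_or_pos i with rfl | hi
    · simp only [Nat.cast_zero, mul_zero, zero_sub, zpow_neg_one, inv_div]
      rw [div_eq_mul_inv]
      exact mul_le_mul_of_nonneg_left (inv_anti₀ hfs0 hfs') hκ.le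
    · obtain ⟨j, rfl⟩ := Nat.exists_eq_succ_of_ne_zero hi.ne'
      have e2 : (2 * ((j.succ : ℕ) : ℤ) - 1) = ((2 * j + 1 : ℕ) : ℤ) := by push_cast; ring
      rw [e2, zpow_natCast, zpow_natCast]
      refine (pow_le_pow_left₀ hε.le hfs _).trans ?_
      exact le_mul_of_one_le_left (by positivity) hκ1
  rw [e]
  refine (mul_le_mul_of_nonneg_left hsum (by positivity)).trans_eq ?_
  ring

theorem integral_cell_le {M : Mesh (m + 1)} {T : Finset (Space (m + 1))} (hT : T ∈ M.elements)
    {g : Space (m + 1) → ℝ} {B : ℝ} (hB : 0 ≤ B) (hg0 : ∀ x, 0 ≤ g x) (hg : ∀ x ∈ cell T, g x ≤ B) :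
    ∫ x in cell T, g x ≤ ballVolume (m + 1) * M.size ^ (m + 1) * B := by
  have hω := (ballVolume_pos (m + 1)).le
  have hs := M.size_nonneg
  have hvol : volume (cell T) ≤ ENNReal.ofReal (ballVolume (m + 1) * M.size ^ (m + 1)) := by
    rcases (cell T).eq_empty_or_nonempty with h | ⟨z, hz⟩
    · simp [h]
    · rw [← volume_closedBall_eq _ z hs]
      exact measure_mono fun x hx => Metric.mem_closedBall.2 (dist_le_size hT hx hz)
  have h1 : ‖∫ x in cell T, g x‖ ≤ B * volume.real (cell T) :=
    norm_setIntegral_le_of_norm_le_const (isCompact_cell T).measure_lt_top fun x hx => by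
      rw [Real.norm_of_nonneg (hg0 x)]; exact hg x hx
  refine (le_abs_self _).trans (h1.trans ?_)
  rw [mul_comm]
  exact mul_le_mul_of_nonneg_right (ENNReal.toReal_le_of_le_ofReal (by positivity) hvol) hB

/-- Transfer of the gradient energy across an interior face. -/
theorem exists_cellEnergy_le (m k : ℕ) (σ ρ : ℝ) : ∃ C : ℝ, 0 ≤ C ∧
    ∀ (M : Mesh (m + 1)) (Ω : Set (Space (m + 1))), M.ShapeRegular σ → M.QuasiUniform Ω ρ →
    ∀ P ∈ M.interiorFaces Ω, ∀ f ∈ polyFun (m + 1) k, ∀ g ∈ polyFun (m + 1) k,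
      cellEnergy P.1 f ≤ C * (cellEnergy P.2 g + facePenalty k P (f - g)) := by
  classical
  obtain ⟨C₁, hC₁, h₁⟩ := exists_fderiv_sq_le_cellEnergy m k σ ρ 1
  obtain ⟨C₂, hC₂, h₂⟩ := exists_fderiv_sq_le_facePenalty m k σ ρ 1
  have hω := (ballVolume_pos (m + 1)).le
  refine ⟨ballVolume (m + 1) * (2 * (C₁ + C₂)), by positivity,
    fun M Ω hS hQ P hP f hf g hg => ?_⟩
  obtain ⟨⟨hT1, hT2⟩, -, -⟩ := mem_interiorFaces.1 hP
  obtain ⟨-, -, z, hz, -⟩ := face_geometry hS hQ hP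
  obtain ⟨hh, -, -⟩ := exists_closedBall_subset hS hQ hT1
  have hE := cellEnergy_nonneg P.2 g
  have hJ := facePenalty_nonneg k P (f - g)
  set E := cellEnergy P.2 g
  set J := facePenalty k P (f - g)
  have hpt : ∀ x ∈ cell P.1, ‖fderiv ℝ f x‖ ^ 2 ≤
      (M.size ^ (m + 1))⁻¹ * (2 * (C₁ + C₂) * (E + J)) := fun x hx => by
    have hd : dist x z ≤ 1 * M.size := by
      rw [one_mul]; exact dist_le_size (mem_active.1 hT1).1 hx hz.1
    have e1 := h₁ M Ω hS hQ P.2 hT2 g hg z hz.2 x hd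
    have e2 := h₂ M Ω hS hQ P hP _ (Submodule.sub_mem _ hf hg) z hz x hd
    rw [fderiv_sub_polyFun hf hg] at e2
    have e3 : ‖fderiv ℝ f x‖ ≤ ‖fderiv ℝ g x‖ + ‖fderiv ℝ f x - fderiv ℝ g x‖ := by
      simpa using norm_add_le (fderiv ℝ g x) (fderiv ℝ f x - fderiv ℝ g x)
    have e4 : ‖fderiv ℝ f x‖ ^ 2 ≤
        2 * ‖fderiv ℝ g x‖ ^ 2 + 2 * ‖fderiv ℝ f x - fderiv ℝ g x‖ ^ 2 :=
      (pow_le_pow_left₀ (norm_nonneg _) e3 2).trans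
        (by nlinarith [sq_nonneg (‖fderiv ℝ g x‖ - ‖fderiv ℝ f x - fderiv ℝ g x‖)])
    have hi : (0 : ℝ) ≤ (M.size ^ (m + 1))⁻¹ := by positivity
    have e5 : 0 ≤ (M.size ^ (m + 1))⁻¹ * (C₁ * J) := by positivity
    have e6 : 0 ≤ (M.size ^ (m + 1))⁻¹ * (C₂ * E) := by positivity
    linarith
  refine (integral_cell_le (mem_active.1 hT1).1 (by positivity) (fun _ => sq_nonneg _) hpt).trans_eq
    ?_
  field_simp

/-- Discrete trace inequality on a piece of surface inside an element. -/
theorem exists_surface_integral_le (m k : ℕ) (σ ρ : ℝ) : ∃ C : ℝ, 0 ≤ C ∧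
    ∀ (M : Mesh (m + 1)) (Ω : Set (Space (m + 1))), M.ShapeRegular σ → M.QuasiUniform Ω ρ →
    ∀ T ∈ M.active Ω, ∀ f ∈ polyFun (m + 1) k, ∀ (S : Set (Space (m + 1))) (B : ℝ), 0 ≤ B →
      S ⊆ cell T → μHE[m] S ≤ ENNReal.ofReal (B * M.size ^ m) →
      M.size * ∫ x in S, ‖fderiv ℝ f x‖ ^ 2 ∂μHE[m] ≤ C * B * cellEnergy T f := by
  obtain ⟨C, hC, h⟩ := exists_fderiv_sq_le_cellEnergy m k σ ρ 1
  refine ⟨C, hC, fun M Ω hS hQ T hT f hf S B hB hST hμ => ?_⟩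
  obtain ⟨hh, -, -⟩ := exists_closedBall_subset hS hQ hT
  have hE := cellEnergy_nonneg T f
  have hfin : μHE[m] S < ⊤ := hμ.trans_lt ENNReal.ofReal_lt_top
  have hpt : ∀ x ∈ cell T, ‖fderiv ℝ f x‖ ^ 2 ≤ C * (M.size ^ (m + 1))⁻¹ * cellEnergy T f :=
    fun x hx => h M Ω hS hQ T hT f hf x hx x (by simp [hh.le])
  have hae : ∀ᵐ x ∂(μHE[m].restrict S), ‖‖fderiv ℝ f x‖ ^ 2‖ ≤
      C * (M.size ^ (m + 1))⁻¹ * cellEnergy T f :=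
    ae_mono (Measure.restrict_mono_set μHE[m] hST)
      ((ae_restrict_iff' (measurableSet_cell T)).2 (ae_of_all _ fun x hx => by
        rw [Real.norm_of_nonneg (sq_nonneg _)]; exact hpt x hx))
  have h1 := (le_abs_self _).trans (norm_setIntegral_le_of_norm_le_const_ae hfin hae)
  have h2 : μHE[m].real S ≤ B * M.size ^ m :=
    ENNReal.toReal_le_of_le_ofReal (by positivity) hμ
  refine (mul_le_mul_of_nonneg_left (h1.trans (mul_le_mul_of_nonneg_left h2 (by positivity)))
    hh.le).trans_eq ?_
  rw [pow_succ]
  field_simp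

end Mesh

/-! ### Summation along walks -/

section walks

variable {ι : Type*} [DecidableEq ι] (A U : Finset ι) (E : Finset (ι × ι))

/-- The vertices of `A` from which `U` is reached in at most `n` steps. -/
def walkLayer : ℕ → Finset ι
  | 0 => U
  | n + 1 => walkLayer n ∪ A.filter fun s => s ∉ U ∧ ∃ t ∈ walkLayer n, (s, t) ∈ E

variable {A U E}

theorem walkLayer_subset (hU : U ⊆ A) (n : ℕ) : walkLayer A U E n ⊆ A := by
  induction n with
  | zero => exact hU
  | succ n ih => exact Finset.union_subset ih (Finset.filter_subset _ _)

theorem walkLayer_mono {n n' : ℕ} (h : n ≤ n') : walkLayer A U E n ⊆ walkLayer A U E n' := by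
  induction h with
  | refl => exact subset_rfl
  | step _ ih => exact ih.trans Finset.subset_union_left

theorem mem_walkLayer_of_walk (hE : ∀ P ∈ E, P.1 ∈ A) (n : ℕ) (c : ℕ → ι) (hc : c n ∈ U)
    (hs : ∀ j < n, (c j, c (j + 1)) ∈ E) : c 0 ∈ walkLayer A U E n := by
  induction n generalizing c with
  | zero => exact hc
  | succ n ih =>
    by_cases h0 : c 0 ∈ U
    · exact walkLayer_mono (Nat.zero_le _) h0
    · have h1 := ih (fun j => c (j + 1)) hc fun j hj => hs (j + 1) (by omega)
      have h2 := hs 0 (by omega)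
      exact Finset.mem_union_right _ (Finset.mem_filter.2 ⟨hE _ h2, h0, _, h1, h2⟩)

/-- Each vertex new in a layer is charged to its edges into the previous layer. A vertex `t` is
charged at most `D` times and an edge at most once, giving the factor `1 + C * D + C` per layer.
Steps start only outside `U`, so only edges starting there enter. Keeping their sum on the left
makes the induction close. -/
theorem sum_le_of_walks (hU : U ⊆ A) {G : ι → ℝ} {J : ι × ι → ℝ} {C D : ℝ}
    (hG : ∀ s, 0 ≤ G s) (hJ : ∀ P, 0 ≤ J P) (hC : 0 ≤ C)
    (hstep : ∀ P ∈ E, G P.1 ≤ C * (G P.2 + J P))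
    (hdeg : ∀ t ∈ A, ((A.filter fun s => (s, t) ∈ E).card : ℝ) ≤ D) (hD : 0 ≤ D) (n : ℕ) :
    ∑ s ∈ walkLayer A U E n, G s + ∑ P ∈ E.filter (fun P => P.1 ∉ U), J P ≤
      (1 + C * D + C) ^ n * (∑ s ∈ U, G s + ∑ P ∈ E.filter (fun P => P.1 ∉ U), J P) := by
  set 𝒥 := ∑ P ∈ E.filter (fun P => P.1 ∉ U), J P with h𝒥
  have h𝒥0 : 0 ≤ 𝒥 := Finset.sum_nonneg fun P _ => hJ P
  induction n with
  | zero => simp [walkLayer]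
  | succ n ih =>
    set L := walkLayer A U E n with hL
    have hL0 : 0 ≤ ∑ s ∈ L, G s := Finset.sum_nonneg fun s _ => hG s
    set N := A.filter fun s => s ∉ U ∧ ∃ t ∈ L, (s, t) ∈ E with hN
    have h1 : ∑ s ∈ L ∪ N, G s ≤ ∑ s ∈ L, G s + ∑ s ∈ N, G s := by
      rw [← Finset.sum_union_inter]
      exact le_add_of_nonneg_right (Finset.sum_nonneg fun s _ => hG s)
    have h2 : ∑ s ∈ N, G s ≤
        ∑ s ∈ N, ∑ t ∈ L.filter (fun t => (s, t) ∈ E), C * (G t + J (s, t)) := by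
      refine Finset.sum_le_sum fun s hs => ?_
      obtain ⟨-, -, t, ht, hst⟩ := Finset.mem_filter.1 hs
      refine (hstep _ hst).trans ?_
      exact Finset.single_le_sum (f := fun t => C * (G t + J (s, t)))
        (fun t _ => mul_nonneg hC (add_nonneg (hG t) (hJ _))) (Finset.mem_filter.2 ⟨ht, hst⟩)
    have h3 : ∑ s ∈ N, ∑ t ∈ L.filter (fun t => (s, t) ∈ E), G t ≤ D * ∑ t ∈ L, G t := by
      simp only [Finset.sum_filter]
      rw [Finset.sum_comm, Finset.mul_sum]
      refine Finset.sum_le_sum fun t ht => ?_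
      rw [← Finset.sum_filter, Finset.sum_const, nsmul_eq_mul]
      refine mul_le_mul_of_nonneg_right (le_trans ?_ (hdeg t (walkLayer_subset hU n ht))) (hG t)
      exact_mod_cast Finset.card_le_card (Finset.filter_subset_filter _ (Finset.filter_subset _ _))
    have h4 : ∑ s ∈ N, ∑ t ∈ L.filter (fun t => (s, t) ∈ E), J (s, t) ≤ 𝒥 := by
      simp only [Finset.sum_filter]
      rw [← Finset.sum_product (f := fun P : ι × ι => if (P.1, P.2) ∈ E then J (P.1, P.2) else 0),
        ← Finset.sum_filter]
      refine Finset.sum_le_sum_of_subset_of_nonneg (fun P hP => ?_) fun P _ _ => hJ P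
      obtain ⟨h5, h6⟩ := Finset.mem_filter.1 hP
      exact Finset.mem_filter.2 ⟨h6, (Finset.mem_filter.1 (Finset.mem_product.1 h5).1).2.1⟩
    have h5 : ∑ s ∈ N, ∑ t ∈ L.filter (fun t => (s, t) ∈ E), C * (G t + J (s, t)) ≤
        C * (D * ∑ t ∈ L, G t + 𝒥) := by
      simp only [← Finset.mul_sum, Finset.sum_add_distrib]
      exact mul_le_mul_of_nonneg_left (add_le_add h3 h4) hC
    have h6 : ∑ s ∈ walkLayer A U E (n + 1), G s ≤ ∑ s ∈ L, G s + C * (D * ∑ t ∈ L, G t + 𝒥) :=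
      h1.trans (by linarith)
    have hCD : 0 ≤ C * D := mul_nonneg hC hD
    have h7 := mul_le_mul_of_nonneg_left ih (by positivity : 0 ≤ 1 + C * D + C)
    rw [pow_succ', mul_assoc]
    nlinarith [mul_nonneg hC hL0, mul_nonneg hCD h𝒥0]

end walks

/-! ### Integrals over the domain -/

namespace Mesh

variable {d k : ℕ} {M : Mesh d} {Ω : Set (Space d)}

/-- The union of the interiors of the active elements. -/
def activeInterior (M : Mesh d) (Ω : Set (Space d)) : Set (Space d) :=
  ⋃ T ∈ M.active Ω, interior (cell T)

/-- Frontiers of convex sets are null. On the disjoint interiors the broken gradient is the gradient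
of a polynomial. -/
theorem extended_ae_eq : (M.extended Ω : Set (Space d)) =ᵐ[volume] M.activeInterior Ω := by
  have h : ∀ T : Finset (Space d), interior (cell T) =ᵐ[volume] cell T := fun T =>
    interior_ae_eq_of_null_frontier ((convex_cell T).addHaar_frontier volume)
  exact Filter.EventuallyEq.symm
    (Filter.EventuallyEq.countable_bUnion (M.active Ω).countable_toSet fun T _ => h T)

theorem subset_extended (h : Ω ⊆ M.region) : Ω ⊆ M.extended Ω := fun x hx => by
  obtain ⟨T, hT, hxT⟩ := Set.mem_iUnion₂.1 (h hx)
  exact Set.mem_iUnion₂.2 ⟨T, mem_active.2 ⟨hT, x, hxT, hx⟩, hxT⟩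

theorem pairwiseDisjoint_interior (A : Finset (Finset (Space d))) (hA : A ⊆ M.elements) :
    (A : Set (Finset (Space d))).PairwiseDisjoint fun T => interior (cell T) :=
  fun _ h₁ _ h₂ hne => Set.disjoint_iff_inter_eq_empty.2
    (interior_cell_inter_eq_empty (hA h₁) (hA h₂) hne)

theorem active_subset_elements : M.active Ω ⊆ M.elements := fun _ hT => (mem_active.1 hT).1

theorem integrableOn_interior {T : Finset (Space d)} {v q : Space d → Space d}
    (hq : q ∈ polyFun d k) (h : ∀ x ∈ interior (cell T), v x = q x) :
    IntegrableOn (fun x => frob (fderiv ℝ v x) (fderiv ℝ v x)) (interior (cell T)) := by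
  have h1 : IntegrableOn (fun x => frob (fderiv ℝ q x) (fderiv ℝ q x)) (interior (cell T)) :=
    ((continuous_frob_fderiv hq).continuousOn.integrableOn_compact (isCompact_cell T)).mono_set
      interior_subset
  refine h1.congr_fun (fun x hx => ?_) isOpen_interior.measurableSet
  simp only [fderiv_eq_of_interior h hx]

theorem setIntegral_interior_frob {T : Finset (Space d)} {v q : Space d → Space d}
    (h : ∀ x ∈ interior (cell T), v x = q x) :
    ∫ x in interior (cell T), frob (fderiv ℝ v x) (fderiv ℝ v x) =
      ∫ x in cell T, frob (fderiv ℝ q x) (fderiv ℝ q x) := by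
  rw [← setIntegral_congr_set (interior_ae_eq_of_null_frontier
    ((convex_cell T).addHaar_frontier volume))]
  refine setIntegral_congr_fun isOpen_interior.measurableSet fun x hx => ?_
  simp only [fderiv_eq_of_interior h hx]

variable {v : Space d → Space d} {p : Finset (Space d) → Space d → Space d}

theorem integrableOn_extended (hp : ∀ T, p T ∈ polyFun d k)
    (hvp : ∀ T ∈ M.active Ω, ∀ x ∈ interior (cell T), v x = p T x) :
    IntegrableOn (fun x => frob (fderiv ℝ v x) (fderiv ℝ v x)) (M.extended Ω) := by
  rw [integrableOn_congr_set_ae extended_ae_eq, activeInterior, integrableOn_finset_iUnion]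
  exact fun T hT => integrableOn_interior (hp T) (hvp T hT)

theorem setIntegral_extended_le (hp : ∀ T, p T ∈ polyFun d k)
    (hvp : ∀ T ∈ M.active Ω, ∀ x ∈ interior (cell T), v x = p T x) :
    ∫ x in M.extended Ω, frob (fderiv ℝ v x) (fderiv ℝ v x) ≤
      d * ∑ T ∈ M.active Ω, cellEnergy T (p T) := by
  rw [setIntegral_congr_set extended_ae_eq, activeInterior,
    integral_biUnion_finset _ (fun T _ => isOpen_interior.measurableSet)
      (pairwiseDisjoint_interior _ active_subset_elements)
      fun T hT => integrableOn_interior (hp T) (hvp T hT), Finset.mul_sum]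
  refine Finset.sum_le_sum fun T hT => ?_
  rw [setIntegral_interior_frob (hvp T hT), cellEnergy, ← integral_const_mul]
  exact integral_mono
    ((continuous_frob_fderiv (hp T)).continuousOn.integrableOn_compact (isCompact_cell T))
    (((continuous_norm_fderiv_sq (hp T)).continuousOn.integrableOn_compact
      (isCompact_cell T)).const_mul _) fun x => frob_self_le _

open Classical in
theorem sum_uncut_le_setIntegral (hΩ : IsOpen Ω) (hreg : Ω ⊆ M.region)
    (hp : ∀ T, p T ∈ polyFun d k)
    (hvp : ∀ T ∈ M.active Ω, ∀ x ∈ interior (cell T), v x = p T x) :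
    ∑ T ∈ M.active Ω \ M.cut Ω, cellEnergy T (p T) ≤
      ∫ x in Ω, frob (fderiv ℝ v x) (fderiv ℝ v x) := by
  have hA : ∀ T ∈ M.active Ω \ M.cut Ω, T ∈ M.active Ω := fun T hT => (Finset.mem_sdiff.1 hT).1
  have h1 : ∫ x in ⋃ T ∈ M.active Ω \ M.cut Ω, interior (cell T),
      frob (fderiv ℝ v x) (fderiv ℝ v x) ≤ ∫ x in Ω, frob (fderiv ℝ v x) (fderiv ℝ v x) := by
    refine setIntegral_mono_set ((integrableOn_extended hp hvp).mono_set (subset_extended hreg))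
      (ae_of_all _ fun x => frob_self_nonneg _) (LE.le.eventuallyLE ?_)
    exact Set.iUnion₂_subset fun T hT => interior_subset.trans
      (cell_subset_of_notMem_cut hΩ (hA T hT) (Finset.mem_sdiff.1 hT).2)
  refine le_trans ?_ h1
  rw [integral_biUnion_finset _ (fun T _ => isOpen_interior.measurableSet)
      (pairwiseDisjoint_interior _ fun T hT => active_subset_elements (hA T hT))
      fun T hT => integrableOn_interior (hp T) (hvp T (hA T hT))]
  refine Finset.sum_le_sum fun T hT => ?_
  rw [setIntegral_interior_frob (hvp T (hA T hT)), cellEnergy]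
  exact integral_mono
    ((continuous_norm_fderiv_sq (hp T)).continuousOn.integrableOn_compact (isCompact_cell T))
    ((continuous_frob_fderiv (hp T)).continuousOn.integrableOn_compact (isCompact_cell T))
    fun x => norm_sq_le_frob _

end Mesh

/-! ### Coercivity -/

theorem two_mul_abs_integral_le {X : Type*} [MeasurableSpace X] {μ : Measure X} {f a b : X → ℝ}
    {s : ℝ} (hs : 0 < s) (ha : Integrable (fun x => a x ^ 2) μ)
    (hb : Integrable (fun x => b x ^ 2) μ) (hf : ∀ᵐ x ∂μ, |f x| ≤ a x * b x) :
    2 * |∫ x, f x ∂μ| ≤ s * ∫ x, a x ^ 2 ∂μ + s⁻¹ * ∫ x, b x ^ 2 ∂μ := by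
  have h1 : ‖∫ x, f x ∂μ‖ ≤ ∫ x, (s / 2 * a x ^ 2 + s⁻¹ / 2 * b x ^ 2) ∂μ := by
    refine norm_integral_le_of_norm_le ((ha.const_mul _).add (hb.const_mul _)) ?_
    filter_upwards [hf] with x hx
    refine hx.trans ?_
    have h2 : a x * b x = (a x * s) * (s⁻¹ * b x) := by field_simp
    have h3 : s / 2 * a x ^ 2 + s⁻¹ / 2 * b x ^ 2 - a x * b x = s⁻¹ / 2 * (s * a x - b x) ^ 2 := by
      field_simp
      ring
    have h4 : 0 ≤ s⁻¹ / 2 * (s * a x - b x) ^ 2 := by positivity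
    linarith
  rw [integral_add (ha.const_mul _) (hb.const_mul _), integral_const_mul, integral_const_mul,
    Real.norm_eq_abs] at h1
  linarith

theorem norm_outwardNormal_le {d : ℕ} (Ω : Set (Space d)) (x : Space d) :
    ‖outwardNormal Ω x‖ ≤ 1 := by
  unfold outwardNormal
  split_ifs with h
  · exact h.choose_spec.1.le
  · simp

theorem boundaryPart_subset {d : ℕ} {Ω : Set (Space d)} {T : Finset (Space d)} :
    boundaryPart Ω T ⊆ frontier Ω ∩ cell T := fun x hx => by
  refine ⟨hx.1, (isCompact_cell T).isClosed.mem_of_tendsto (b := 𝓝[>] (0 : ℝ))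
    (f := fun t => x - t • outwardNormal Ω x) ?_ (hx.2.mono fun t ht => interior_subset ht)⟩
  have h : Continuous fun t : ℝ => x - t • outwardNormal Ω x := by fun_prop
  simpa using (h.tendsto 0).mono_left nhdsWithin_le_nhds

namespace Mesh

variable {m k : ℕ} {σ ρ : ℝ} {M : Mesh (m + 1)} {Ω : Set (Space (m + 1))}
  {v : Space (m + 1) → Space (m + 1)} {p : Finset (Space (m + 1)) → Space (m + 1) → Space (m + 1)}

theorem interior_cell_nonempty (hS : M.ShapeRegular σ) {T : Finset (Space (m + 1))}
    (hT : T ∈ M.active Ω) : (interior (cell T)).Nonempty := by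
  obtain ⟨c, r, hr, hc, -⟩ := hS T (mem_active.1 hT).1
  exact ⟨c, interior_maximal (Metric.ball_subset_closedBall.trans hc) Metric.isOpen_ball
    (Metric.mem_ball_self hr)⟩

theorem mem_active_of_mem_interiorFaces {d : ℕ} {M : Mesh d} {Ω : Set (Space d)}
    {P : Finset (Space d) × Finset (Space d)}
    (hP : P ∈ M.interiorFaces Ω) : P.1 ∈ M.active Ω ∧ P.2 ∈ M.active Ω := by
  classical
  exact (mem_interiorFaces.1 hP).1

theorem mem_ghostFaces {d : ℕ} {M : Mesh d} {Ω : Set (Space d)}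
    {P : Finset (Space d) × Finset (Space d)} :
    P ∈ M.ghostFaces Ω ↔ P ∈ M.interiorFaces Ω ∧ (P.1 ∈ M.cut Ω ∨ P.2 ∈ M.cut Ω) := by
  simp [ghostFaces]

/-- The ghost penalty extends control of the gradient from `Ω` to the extended domain. -/
theorem exists_sum_cellEnergy_le (m k N : ℕ) (σ ρ : ℝ) : ∃ K : ℝ, 0 < K ∧
    ∀ (M : Mesh (m + 1)) (Ω : Set (Space (m + 1))), IsOpen Ω → Ω ⊆ M.region →
    M.ShapeRegular σ → M.QuasiUniform Ω ρ → M.WalkToUncut Ω N →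
    ∀ (v : Space (m + 1) → Space (m + 1))
      (p : Finset (Space (m + 1)) → Space (m + 1) → Space (m + 1)),
      (∀ T, p T ∈ polyFun (m + 1) k) →
      (∀ T ∈ M.active Ω, ∀ x ∈ interior (cell T), v x = p T x) →
      ∑ T ∈ M.active Ω, cellEnergy T (p T) ≤
        K * ((∫ x in Ω, frob (fderiv ℝ v x) (fderiv ℝ v x)) +
          ∑ P ∈ M.ghostFaces Ω, facePenalty k P (p P.1 - p P.2)) := by
  classical
  obtain ⟨C, hC, hstep⟩ := exists_cellEnergy_le m k σ ρ
  set D := (2 * shapeConst σ ρ) ^ (m + 1)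
  have hD : 0 ≤ D := pow_nonneg (mul_nonneg zero_le_two (shapeConst_pos σ ρ).le) _
  refine ⟨(1 + C * D + C) ^ N, by positivity, fun M Ω hΩ hreg hS hQ hW v p hp hvp => ?_⟩
  have hU := sum_uncut_le_setIntegral hΩ hreg hp hvp
  set U := M.active Ω \ M.cut Ω with hUdef
  have hact : ∀ P ∈ M.interiorFaces Ω, P.1 ∈ M.active Ω := fun P hP =>
    (mem_active_of_mem_interiorFaces hP).1
  have hmain := sum_le_of_walks (A := M.active Ω) (U := U) (E := M.interiorFaces Ω)
    Finset.sdiff_subset (G := fun T => cellEnergy T (p T))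
    (J := fun P => facePenalty k P (p P.1 - p P.2)) (fun T => cellEnergy_nonneg _ _)
    (fun P => facePenalty_nonneg _ _ _) hC
    (fun P hP => hstep M Ω hS hQ P hP _ (hp P.1) _ (hp P.2)) (D := D)
    (fun T hT => by
      refine le_trans ?_ (card_neighbors_le hS hQ hT)
      refine Nat.cast_le.2 (Finset.card_le_card fun T' hT' => ?_)
      simp only [Finset.mem_filter] at hT'
      obtain ⟨h1, h2⟩ := hT'
      obtain ⟨-, -, y, hy, -⟩ := face_geometry hS hQ h2
      exact Finset.mem_filter.2 ⟨h1, y, hy.2, hy.1⟩) hD N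
  have hlayer : M.active Ω ⊆ walkLayer (M.active Ω) U (M.interiorFaces Ω) N := fun T hT => by
    by_cases hc : T ∈ M.cut Ω
    · obtain ⟨l, c, hl, rfl, hcl, hcl', hs⟩ := hW T hc
      exact walkLayer_mono (by omega)
        (mem_walkLayer_of_walk hact l c (Finset.mem_sdiff.2 ⟨hcl, hcl'⟩) hs)
    · exact walkLayer_mono (Nat.zero_le N) (Finset.mem_sdiff.2 ⟨hT, hc⟩)
  -- An edge starting at an active element outside `U` starts at a cut element, so it is a ghost
  -- face.
  have hJ : ∑ P ∈ (M.interiorFaces Ω).filter (fun P => P.1 ∉ U), facePenalty k P (p P.1 - p P.2) ≤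
      ∑ P ∈ M.ghostFaces Ω, facePenalty k P (p P.1 - p P.2) := by
    refine Finset.sum_le_sum_of_subset_of_nonneg (fun P hP => ?_)
      fun P _ _ => facePenalty_nonneg _ _ _
    obtain ⟨h1, h2⟩ := Finset.mem_filter.1 hP
    refine mem_ghostFaces.2 ⟨h1, Or.inl ?_⟩
    by_contra h3
    exact h2 (Finset.mem_sdiff.2 ⟨hact P h1, h3⟩)
  have hJ0 : 0 ≤ ∑ P ∈ (M.interiorFaces Ω).filter (fun P => P.1 ∉ U),
      facePenalty k P (p P.1 - p P.2) := Finset.sum_nonneg fun P _ => facePenalty_nonneg _ _ _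
  have hL := Finset.sum_le_sum_of_subset_of_nonneg (f := fun T => cellEnergy T (p T)) hlayer
    fun T _ _ => cellEnergy_nonneg _ _
  refine (hL.trans (le_add_of_nonneg_right hJ0)).trans (hmain.trans ?_)
  exact mul_le_mul_of_nonneg_left (add_le_add hU hJ) (by positivity)

/-! ### Traces and the ghost penalty in terms of the element polynomials -/

theorem elemTrace_discrete (hS : M.ShapeRegular σ) (hp : ∀ T, p T ∈ polyFun (m + 1) k)
    (hvp : ∀ T ∈ M.active Ω, ∀ x ∈ interior (cell T), v x = p T x)
    {T : Finset (Space (m + 1))} (hT : T ∈ M.active Ω) {x : Space (m + 1)} (hx : x ∈ cell T) :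
    elemTrace T v x = p T x :=
  elemTrace_eq (differentiable_polyFun (hp T)).continuous (hvp T hT)
    (interior_cell_nonempty hS hT) hx

theorem elemTrace_fderiv (hS : M.ShapeRegular σ) (hp : ∀ T, p T ∈ polyFun (m + 1) k)
    (hvp : ∀ T ∈ M.active Ω, ∀ x ∈ interior (cell T), v x = p T x)
    {T : Finset (Space (m + 1))} (hT : T ∈ M.active Ω) {x : Space (m + 1)} (hx : x ∈ cell T) :
    elemTrace T (fderiv ℝ v) x = fderiv ℝ (p T) x :=
  elemTrace_eq (continuous_fderiv_polyFun (hp T))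
    (fun _ hy => fderiv_eq_of_interior (hvp T hT) hy) (interior_cell_nonempty hS hT) hx

theorem elemTrace_normalDeriv (hS : M.ShapeRegular σ) (hp : ∀ T, p T ∈ polyFun (m + 1) k)
    (hvp : ∀ T ∈ M.active Ω, ∀ x ∈ interior (cell T), v x = p T x)
    {T : Finset (Space (m + 1))} (hT : T ∈ M.active Ω) (i : ℕ) (n : Space (m + 1))
    {x : Space (m + 1)} (hx : x ∈ cell T) :
    elemTrace T (normalDeriv i n v) x = normalDeriv i n (p T) x :=
  elemTrace_eq (continuous_normalDeriv (hp T) n)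
    (fun _ hy => normalDeriv_eq_of_interior (hvp T hT) i n hy) (interior_cell_nonempty hS hT) hx

theorem jForm_eq (hS : M.ShapeRegular σ) (hp : ∀ T, p T ∈ polyFun (m + 1) k)
    (hvp : ∀ T ∈ M.active Ω, ∀ x ∈ interior (cell T), v x = p T x) (γ : ℝ) :
    M.jForm Ω k γ v v =
      γ * ((1 / 2) * ∑ P ∈ M.ghostFaces Ω, facePenalty k P (p P.1 - p P.2)) := by
  rw [jForm, ghostSum]
  congr 2
  refine Finset.sum_congr rfl fun P hP => Finset.sum_congr rfl fun i _ => ?_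
  obtain ⟨h1, h2⟩ := mem_active_of_mem_interiorFaces (mem_ghostFaces.1 hP).1
  refine setIntegral_congr_fun (isCompact_face P).isClosed.measurableSet fun x hx => ?_
  simp only [jump]
  rw [elemTrace_normalDeriv hS hp hvp h1 _ _ hx.1, elemTrace_normalDeriv hS hp hvp h2 _ _ hx.2,
    normalDeriv_sub (hp _) (hp _), real_inner_self_eq_norm_sq, Pi.sub_apply]

/-- Goes through the measurable set `cell T`, so that no measurability of `S` is needed; it is
applied to `boundaryPart Ω T`. -/
theorem ae_restrict_of_forall_cell {T : Finset (Space (m + 1))} {S : Set (Space (m + 1))}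
    (hST : S ⊆ cell T) {q : Space (m + 1) → Prop} (h : ∀ x ∈ cell T, q x)
    (μ : Measure (Space (m + 1))) : ∀ᵐ x ∂μ.restrict S, q x :=
  ae_mono (Measure.restrict_mono_set μ hST)
    ((ae_restrict_iff' (measurableSet_cell T)).2 (ae_of_all _ h))

theorem abs_inner_apply_le {d : ℕ} (A : Space d →L[ℝ] Space d) (n w : Space d) (hn : ‖n‖ ≤ 1) :
    |inner ℝ (A n) w| ≤ ‖A‖ * ‖w‖ := by
  refine (abs_real_inner_le_norm _ _).trans (mul_le_mul_of_nonneg_right ?_ (norm_nonneg _))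
  exact (A.le_opNorm _).trans (mul_le_of_le_one_right A.opNorm_nonneg hn)

/-- Young with weight `δ h`, then the discrete trace inequality on the boundary piece. `Ω` enters
the constant only through the regularity constant `B` of its boundary, not through the position of
the mesh. -/
theorem exists_boundary_term_le (m k : ℕ) (σ ρ : ℝ) (Ω : Set (Space (m + 1))) (hΩ : IsOpen Ω)
    (hb : Bornology.IsBounded Ω) (hl : HasLipschitzBoundary Ω) : ∃ C : ℝ, 0 ≤ C ∧
    ∀ (M : Mesh (m + 1)), M.ShapeRegular σ → M.QuasiUniform Ω ρ →
    ∀ (v : Space (m + 1) → Space (m + 1))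
      (p : Finset (Space (m + 1)) → Space (m + 1) → Space (m + 1)),
      (∀ T, p T ∈ polyFun (m + 1) k) →
      (∀ T ∈ M.active Ω, ∀ x ∈ interior (cell T), v x = p T x) →
    ∀ T ∈ M.active Ω, ∀ δ : ℝ, 0 < δ →
      2 * |∫ x in boundaryPart Ω T, inner ℝ (elemTrace T v x)
        (elemTrace T (fderiv ℝ v) x (outwardNormal Ω x)) ∂μHE[m]| ≤
      δ * C * cellEnergy T (p T) +
        δ⁻¹ * M.size⁻¹ * ∫ x in boundaryPart Ω T, ‖elemTrace T v x‖ ^ 2 ∂μHE[m] := by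
  obtain ⟨B, hB, hμ⟩ := exists_measure_frontier_inter_le hΩ hb hl
  obtain ⟨C, hC, htr⟩ := exists_surface_integral_le m k σ ρ
  refine ⟨C * B, by positivity, fun M hS hQ v p hp hvp T hT δ hδ => ?_⟩
  obtain ⟨hh, -, -⟩ := exists_closedBall_subset hS hQ hT
  have hsub : boundaryPart Ω T ⊆ cell T := boundaryPart_subset.trans Set.inter_subset_right
  have hmeas : μHE[m] (boundaryPart Ω T) ≤ ENNReal.ofReal (B * M.size ^ m) :=
    (measure_mono boundaryPart_subset).trans (hμ (cell T) M.size hh.le fun x hx y hy =>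
      dist_le_size (mem_active.1 hT).1 hx hy)
  have hfin : μHE[m] (boundaryPart Ω T) ≠ ⊤ := (hmeas.trans_lt ENNReal.ofReal_lt_top).ne
  have hK := isCompact_cell T
  have hcongr : ∫ x in boundaryPart Ω T, ‖elemTrace T v x‖ ^ 2 ∂μHE[m] =
      ∫ x in boundaryPart Ω T, ‖p T x‖ ^ 2 ∂μHE[m] :=
    integral_congr_ae (ae_restrict_of_forall_cell hsub (fun x hx => by
      beta_reduce; rw [elemTrace_discrete hS hp hvp hT hx]) _)
  have hy := two_mul_abs_integral_le (μ := μHE[m].restrict (boundaryPart Ω T))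
    (f := fun x => inner ℝ (elemTrace T v x)
        (elemTrace T (fderiv ℝ v) x (outwardNormal Ω x)))
    (a := fun x => ‖fderiv ℝ (p T) x‖) (b := fun x => ‖p T x‖) (mul_pos hδ hh)
    (integrableOn_of_subset_isCompact hK hsub hfin (continuous_norm_fderiv_sq (hp T)))
    (integrableOn_of_subset_isCompact hK hsub hfin
      ((differentiable_polyFun (hp T)).continuous.norm.pow 2))
    (ae_restrict_of_forall_cell hsub (fun x hx => by
      rw [elemTrace_discrete hS hp hvp hT hx, elemTrace_fderiv hS hp hvp hT hx, real_inner_comm]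
      exact abs_inner_apply_le _ _ _ (norm_outwardNormal_le Ω x)) _)
  rw [hcongr]
  refine hy.trans ?_
  have h1 := mul_le_mul_of_nonneg_left
    (htr M Ω hS hQ T hT (p T) (hp T) (boundaryPart Ω T) B hB hsub hmeas) hδ.le
  rw [mul_inv]
  linarith

/-- The same argument on a planar piece; the average of the two gradients is split between the two
elements. -/
theorem exists_face_term_le (m k : ℕ) (σ ρ : ℝ) : ∃ C : ℝ, 0 ≤ C ∧
    ∀ (M : Mesh (m + 1)) (Ω : Set (Space (m + 1))), IsOpen Ω →
    M.ShapeRegular σ → M.QuasiUniform Ω ρ →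
    ∀ (v : Space (m + 1) → Space (m + 1))
      (p : Finset (Space (m + 1)) → Space (m + 1) → Space (m + 1)),
      (∀ T, p T ∈ polyFun (m + 1) k) →
      (∀ T ∈ M.active Ω, ∀ x ∈ interior (cell T), v x = p T x) →
    ∀ P ∈ M.interiorFaces Ω, ∀ δ : ℝ, 0 < δ →
      ∫ x in face P ∩ Ω, (inner ℝ (average P (fderiv ℝ v) x (faceNormal P)) (jump P v x)
        + inner ℝ (average P (fderiv ℝ v) x (faceNormal P)) (jump P v x)) ∂μHE[m] ≤
      δ * C * (cellEnergy P.1 (p P.1) + cellEnergy P.2 (p P.2)) +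
        δ⁻¹ * M.size⁻¹ * ∫ x in face P ∩ Ω, ‖jump P v x‖ ^ 2 ∂μHE[m] := by
  obtain ⟨C, hC, htr⟩ := exists_surface_integral_le m k σ ρ
  have hω := (ballVolume_pos m).le
  refine ⟨C * ballVolume m, by positivity, fun M Ω hΩ hS hQ v p hp hvp P hP δ hδ => ?_⟩
  obtain ⟨h1, h2⟩ := mem_active_of_mem_interiorFaces hP
  obtain ⟨hh, -, -⟩ := exists_closedBall_subset hS hQ h1
  obtain ⟨hn, -, -⟩ := face_geometry hS hQ hP
  have hsub1 : face P ∩ Ω ⊆ cell P.1 := fun x hx => hx.1.1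
  have hsub2 : face P ∩ Ω ⊆ cell P.2 := fun x hx => hx.1.2
  have hm : MeasurableSet (face P ∩ Ω) :=
    (isCompact_face P).isClosed.measurableSet.inter hΩ.measurableSet
  have hmeas : μHE[m] (face P ∩ Ω) ≤ ENNReal.ofReal (ballVolume m * M.size ^ m) :=
    (measure_mono Set.inter_subset_left).trans (measure_face_le hS hQ hP)
  have hfin : μHE[m] (face P ∩ Ω) ≠ ⊤ := (hmeas.trans_lt ENNReal.ofReal_lt_top).ne
  have hj : ∀ x ∈ face P ∩ Ω, jump P v x = p P.1 x - p P.2 x := fun x hx => by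
    rw [jump, elemTrace_discrete hS hp hvp h1 hx.1.1, elemTrace_discrete hS hp hvp h2 hx.1.2]
  have ha : ∀ x ∈ face P ∩ Ω, average P (fderiv ℝ v) x =
      (1 / 2 : ℝ) • (fderiv ℝ (p P.1) x + fderiv ℝ (p P.2) x) := fun x hx => by
    rw [average, elemTrace_fderiv hS hp hvp h1 hx.1.1, elemTrace_fderiv hS hp hvp h2 hx.1.2]
  have hcongr : ∫ x in face P ∩ Ω, ‖jump P v x‖ ^ 2 ∂μHE[m] =
      ∫ x in face P ∩ Ω, ‖p P.1 x - p P.2 x‖ ^ 2 ∂μHE[m] :=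
    setIntegral_congr_fun hm fun x hx => by simp only [hj x hx]
  have hc1 := continuous_fderiv_polyFun (hp P.1)
  have hc2 := continuous_fderiv_polyFun (hp P.2)
  have hK := isCompact_cell P.1
  have hia := integrableOn_of_subset_isCompact hK hsub1 hfin
    (f := fun x => ‖(1 / 2 : ℝ) • (fderiv ℝ (p P.1) x + fderiv ℝ (p P.2) x)‖ ^ 2) (by fun_prop)
  have hy := two_mul_abs_integral_le (μ := μHE[m].restrict (face P ∩ Ω))
    (f := fun x => inner ℝ (average P (fderiv ℝ v) x (faceNormal P)) (jump P v x))
    (a := fun x => ‖(1 / 2 : ℝ) • (fderiv ℝ (p P.1) x + fderiv ℝ (p P.2) x)‖)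
    (b := fun x => ‖p P.1 x - p P.2 x‖) (mul_pos hδ hh) hia
    (integrableOn_of_subset_isCompact hK hsub1 hfin
      (((differentiable_polyFun (hp P.1)).continuous.sub
        (differentiable_polyFun (hp P.2)).continuous).norm.pow 2))
    ((ae_restrict_iff' hm).2 (ae_of_all _ fun x hx => by
      rw [hj x hx, ha x hx]
      exact abs_inner_apply_le _ _ _ hn.le))
  have hi1 := integrableOn_of_subset_isCompact hK hsub1 hfin (continuous_norm_fderiv_sq (hp P.1))
  have hi2 := integrableOn_of_subset_isCompact hK hsub1 hfin (continuous_norm_fderiv_sq (hp P.2))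
  have havg : ∫ x in face P ∩ Ω,
      ‖(1 / 2 : ℝ) • (fderiv ℝ (p P.1) x + fderiv ℝ (p P.2) x)‖ ^ 2 ∂μHE[m] ≤
      ∫ x in face P ∩ Ω, ‖fderiv ℝ (p P.1) x‖ ^ 2 ∂μHE[m] +
        ∫ x in face P ∩ Ω, ‖fderiv ℝ (p P.2) x‖ ^ 2 ∂μHE[m] := by
    rw [← integral_add hi1 hi2]
    refine integral_mono hia (hi1.add hi2) fun x => ?_
    beta_reduce
    rw [norm_smul, mul_pow]
    have h3 := pow_le_pow_left₀ (norm_nonneg _)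
      (norm_add_le (fderiv ℝ (p P.1) x) (fderiv ℝ (p P.2) x)) 2
    have h4 : ‖(1 / 2 : ℝ)‖ ^ 2 = 1 / 4 := by norm_num
    rw [h4]
    nlinarith [sq_nonneg (‖fderiv ℝ (p P.1) x‖ - ‖fderiv ℝ (p P.2) x‖),
      sq_nonneg ‖fderiv ℝ (p P.1) x‖, sq_nonneg ‖fderiv ℝ (p P.2) x‖]
  have e1 := htr M Ω hS hQ P.1 h1 _ (hp P.1) _ _ hω hsub1 hmeas
  have e2 := htr M Ω hS hQ P.2 h2 _ (hp P.2) _ _ hω hsub2 hmeas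
  have e3 := mul_le_mul_of_nonneg_left havg (mul_pos hδ hh).le
  have e4 := mul_le_mul_of_nonneg_left (add_le_add e1 e2) hδ.le
  have e5 : ∫ x in face P ∩ Ω, (inner ℝ (average P (fderiv ℝ v) x (faceNormal P)) (jump P v x)
        + inner ℝ (average P (fderiv ℝ v) x (faceNormal P)) (jump P v x)) ∂μHE[m] =
      2 * ∫ x in face P ∩ Ω,
        inner ℝ (average P (fderiv ℝ v) x (faceNormal P)) (jump P v x) ∂μHE[m] := by
    rw [← integral_const_mul]
    simp only [two_mul]
  rw [e5, hcongr]
  have e6 := le_abs_self (∫ x in face P ∩ Ω,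
    inner ℝ (average P (fderiv ℝ v) x (faceNormal P)) (jump P v x) ∂μHE[m])
  rw [mul_inv] at hy
  linarith

theorem sum_interiorFaces_le (hS : M.ShapeRegular σ) (hQ : M.QuasiUniform Ω ρ)
    {G : Finset (Space (m + 1)) → ℝ} (hG : ∀ T, 0 ≤ G T) :
    ∑ P ∈ M.interiorFaces Ω, (G P.1 + G P.2) ≤
      2 * (2 * shapeConst σ ρ) ^ (m + 1) * ∑ T ∈ M.active Ω, G T := by
  classical
  have key : ∑ P ∈ M.interiorFaces Ω, G P.1 ≤
      (2 * shapeConst σ ρ) ^ (m + 1) * ∑ T ∈ M.active Ω, G T := by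
    have h1 : M.interiorFaces Ω =
        (M.active Ω ×ˢ M.active Ω).filter (fun P => (P.1, P.2) ∈ M.interiorFaces Ω) := by
      ext P
      rw [Finset.mem_filter, Finset.mem_product]
      exact ⟨fun h => ⟨mem_active_of_mem_interiorFaces h, h⟩, fun h => h.2⟩
    rw [h1, Finset.sum_filter, Finset.sum_product, Finset.mul_sum]
    refine Finset.sum_le_sum fun T hT => ?_
    rw [← Finset.sum_filter]
    dsimp only
    rw [Finset.sum_const, nsmul_eq_mul]
    refine mul_le_mul_of_nonneg_right (le_trans ?_ (card_neighbors_le hS hQ hT)) (hG T)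
    refine Nat.cast_le.2 (Finset.card_le_card fun T' hT' => ?_)
    simp only [Finset.mem_filter] at hT'
    obtain ⟨h2, h3⟩ := hT'
    obtain ⟨-, -, y, hy, -⟩ := face_geometry hS hQ h3
    exact Finset.mem_filter.2 ⟨h2, y, hy⟩
  have hswap : ∑ P ∈ M.interiorFaces Ω, G P.2 = ∑ P ∈ M.interiorFaces Ω, G P.1 :=
    Finset.sum_nbij' Prod.swap Prod.swap (fun P hP => swap_mem_interiorFaces hP)
      (fun P hP => swap_mem_interiorFaces hP) (fun _ _ => rfl) (fun _ _ => rfl) fun _ _ => rfl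
  rw [Finset.sum_add_distrib, hswap]
  linarith

/-- `I` and `J` are the energy on `Ω` and the ghost sum, `G` the energy on whole elements, `B` and
`F` the squared traces and jumps, `Y` and `Z` the consistency terms, and `η` is `h⁻¹`. The good
terms dominate `G / K`. The choice of `δ` spends half of it on consistency, the other half pays for
`X`, and `β ≥ δ⁻¹ + 1` leaves one full unit of penalty. The factors `1 / 2` come from counting faces
as ordered pairs. -/
theorem coercivity_of_bounds {I X J B F Y Z G η K₀ γ D C₁ C₂ β δ K C n : ℝ} (hγ : 0 < γ)
    (hK₀ : 0 < K₀) (hC₁ : 0 ≤ C₁) (hC₂ : 0 ≤ C₂) (hD : 0 ≤ D) (hn : 0 < n) (hI : 0 ≤ I) (hJ : 0 ≤ J)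
    (hG : 0 ≤ G) (hη : 0 ≤ η) (hB : 0 ≤ B) (hF : 0 ≤ F) (hGK : G ≤ K₀ * (I + J)) (hX : X ≤ n * G)
    (hY : 2 * Y ≤ δ * C₁ * G + δ⁻¹ * η * B) (hZ : Z ≤ δ * C₂ * (2 * D * G) + δ⁻¹ * η * F)
    (hKdef : K = K₀ * (1 + 2 / γ)) (hCdef : C = C₁ + C₂ * D + 1) (hδdef : δ = (2 * K * C)⁻¹)
    (hβ : δ⁻¹ + 1 ≤ β) :
    min 1 (1 / (2 * K * n)) * (X + η * B + η * (1 / 2 * F)) ≤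
      I - 1 / 2 * Z - Y - Y + β * η * B + β * η * (1 / 2 * F) + γ * (1 / 2 * J) := by
  have hK : 0 < K := by rw [hKdef]; positivity
  have hC : 0 < C := by rw [hCdef]; positivity
  have hS : 0 ≤ η * B + η * (1 / 2 * F) := by positivity
  have h1 : G / K ≤ I + γ * (1 / 2 * J) := by
    rw [div_le_iff₀ hK, hKdef]
    refine hGK.trans ?_
    have h2 : (I + γ * (1 / 2 * J)) * (K₀ * (1 + 2 / γ)) - K₀ * (I + J) =
        K₀ * (I * (2 / γ) + γ * (1 / 2 * J)) := by
      field_simp; ring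
    have h3 : 0 ≤ K₀ * (I * (2 / γ) + γ * (1 / 2 * J)) := by positivity
    linarith
  have h2 : δ * C * G = G / (2 * K) := by
    rw [hδdef]; field_simp
  have h3 : G / K = 2 * (G / (2 * K)) := by field_simp
  have hδ : 0 < δ := by rw [hδdef]; positivity
  have h4 : min 1 (1 / (2 * K * n)) * X ≤ G / (2 * K) := by
    have h5 : 0 ≤ min 1 (1 / (2 * K * n)) := le_min zero_le_one (by positivity)
    refine (mul_le_mul_of_nonneg_left hX h5).trans ?_
    refine (mul_le_mul_of_nonneg_right (min_le_right _ _) (by positivity)).trans_eq ?_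
    field_simp
  have h6 : min 1 (1 / (2 * K * n)) * (η * B + η * (1 / 2 * F)) ≤ η * B + η * (1 / 2 * F) :=
    mul_le_of_le_one_left hS (min_le_left _ _)
  have h7 : (δ⁻¹ + 1) * (η * B + η * (1 / 2 * F)) ≤ β * (η * B + η * (1 / 2 * F)) :=
    mul_le_mul_of_nonneg_right hβ hS
  have h8 : δ * C * G = δ * C₁ * G + δ * C₂ * D * G + δ * G := by rw [hCdef]; ring
  have h9 : 0 ≤ δ * G := by positivity
  linarith

theorem exists_coercive (m k N : ℕ) (Ω : Set (Space (m + 1))) (hΩ : IsOpen Ω)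
    (hb : Bornology.IsBounded Ω) (hl : HasLipschitzBoundary Ω) (γ σ ρ : ℝ) (hγ : 0 < γ) :
    ∃ β₀ : ℝ, 0 < β₀ ∧ ∀ β : ℝ, β₀ ≤ β → ∃ c : ℝ, 0 < c ∧
      ∀ M : Mesh (m + 1), Ω ⊆ M.region → M.ShapeRegular σ → M.QuasiUniform Ω ρ →
        M.WalkToUncut Ω N → ∀ v : Space (m + 1) → Space (m + 1), M.IsDiscrete Ω k v →
          c * M.normVSq Ω v ≤ M.aForm Ω β v v + M.jForm Ω k γ v v := by
  obtain ⟨K₀, hK₀, hghost⟩ := exists_sum_cellEnergy_le m k N σ ρ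
  obtain ⟨C₁, hC₁, hbd⟩ := exists_boundary_term_le m k σ ρ Ω hΩ hb hl
  obtain ⟨C₂, hC₂, hfc⟩ := exists_face_term_le m k σ ρ
  set D := (2 * shapeConst σ ρ) ^ (m + 1) with hDdef
  have hD : 0 ≤ D := pow_nonneg (mul_nonneg zero_le_two (shapeConst_pos σ ρ).le) _
  set K := K₀ * (1 + 2 / γ) with hKdef
  have hK : 0 < K := by positivity
  set C := C₁ + C₂ * D + 1 with hCdef
  have hC : 0 < C := by positivity
  set δ := (2 * K * C)⁻¹ with hδdef
  have hδ : 0 < δ := by positivity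
  refine ⟨δ⁻¹ + 1, by positivity, fun β hβ =>
    ⟨min 1 (1 / (2 * K * (m + 1))), lt_min one_pos (by positivity),
      fun M hreg hS hQ hW v hv => ?_⟩⟩
  obtain ⟨p, hp, hvp⟩ := hv.exists_polyFun
  have hg := hghost M Ω hΩ hreg hS hQ hW v p hp hvp
  have hext := setIntegral_extended_le hp hvp
  have hj := jForm_eq hS hp hvp γ
  have hI0 : 0 ≤ ∫ x in Ω, frob (fderiv ℝ v x) (fderiv ℝ v x) :=
    integral_nonneg fun x => frob_self_nonneg _
  have hJ0 : 0 ≤ ∑ P ∈ M.ghostFaces Ω, facePenalty k P (p P.1 - p P.2) :=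
    Finset.sum_nonneg fun P _ => facePenalty_nonneg _ _ _
  have hG0 : 0 ≤ ∑ T ∈ M.active Ω, cellEnergy T (p T) :=
    Finset.sum_nonneg fun T _ => cellEnergy_nonneg _ _
  have hbd' := Finset.sum_le_sum fun T hT => hbd M hS hQ v p hp hvp T hT δ hδ
  have hfc' := Finset.sum_le_sum fun P hP => hfc M Ω hΩ hS hQ v p hp hvp P hP δ hδ
  have hdeg := sum_interiorFaces_le hS hQ (Ω := Ω) (G := fun T => cellEnergy T (p T))
    fun T => cellEnergy_nonneg _ _
  simp only [Finset.sum_add_distrib, ← Finset.mul_sum] at hbd' hfc' hdeg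
  rw [normVSq, aForm, hj]
  simp only [boundaryIntegral, faceSum, Nat.add_one_sub_one, real_inner_self_eq_norm_sq]
  have habs : ∑ T ∈ M.active Ω, ∫ x in boundaryPart Ω T, inner ℝ (elemTrace T v x)
        (elemTrace T (fderiv ℝ v) x (outwardNormal Ω x)) ∂μHE[m] ≤
      ∑ T ∈ M.active Ω, |∫ x in boundaryPart Ω T, inner ℝ (elemTrace T v x)
        (elemTrace T (fderiv ℝ v) x (outwardNormal Ω x)) ∂μHE[m]| :=
    Finset.sum_le_sum fun T _ => le_abs_self _
  have hB0 : 0 ≤ ∑ T ∈ M.active Ω, ∫ x in boundaryPart Ω T, ‖elemTrace T v x‖ ^ 2 ∂μHE[m] :=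
    Finset.sum_nonneg fun T _ => integral_nonneg fun x => sq_nonneg _
  have hF0 : 0 ≤ ∑ P ∈ M.interiorFaces Ω, ∫ x in face P ∩ Ω, ‖jump P v x‖ ^ 2 ∂μHE[m] :=
    Finset.sum_nonneg fun P _ => integral_nonneg fun x => sq_nonneg _
  have hs := M.size_nonneg
  rw [← hDdef] at hdeg
  push_cast at hext
  have hY := (mul_le_mul_of_nonneg_left habs zero_le_two).trans hbd'
  have hZ := hfc'.trans (add_le_add_left
    (mul_le_mul_of_nonneg_left hdeg (mul_nonneg hδ.le hC₂)) _)
  exact coercivity_of_bounds hγ hK₀ hC₁ hC₂ hD (by positivity) hI0 hJ0 hG0 (inv_nonneg.2 hs) hB0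
    hF0 hg hext hY hZ hKdef hCdef hδdef hβ

end Mesh

end

end UnfittedDG

theorem lemma4 (d k N : ℕ) (hd : d = 2 ∨ d = 3) (hk : 1 ≤ k)
    (Ω : Set (UnfittedDG.Space d)) (hΩ_open : IsOpen Ω) (hΩ_bdd : Bornology.IsBounded Ω)
    (hΩ_lip : UnfittedDG.HasLipschitzBoundary Ω)
    (γ σ ρ : ℝ) (hγ : 0 < γ) :
    ∃ β₀ : ℝ, 0 < β₀ ∧ ∀ β : ℝ, β₀ ≤ β → ∃ c : ℝ, 0 < c ∧
      ∀ M : UnfittedDG.Mesh d, Ω ⊆ M.region → M.ShapeRegular σ → M.QuasiUniform Ω ρ →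
        M.WalkToUncut Ω N →
        ∀ v : UnfittedDG.Space d → UnfittedDG.Space d, M.IsDiscrete Ω k v →
          c * M.normVSq Ω v ≤ M.aForm Ω β v v + M.jForm Ω k γ v v := by
  -- With `d = m + 1`, hyperplanes are isometric copies of `ℝ^m` and the surface dimension `d - 1`
  -- is `m`.
  obtain ⟨m, rfl⟩ : ∃ m, d = m + 1 := ⟨d - 1, by omega⟩
  exact UnfittedDG.Mesh.exists_coercive m k N Ω hΩ_open hΩ_bdd hΩ_lip γ σ ρ hγ
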